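/- Let $\Omega\subset\mathbb{R}^3$ be a bounded domain (a nonempty, connected, bounded open set) with $\partial\Omega\in C^{1,\alpha}$ for some $0<\alpha\le 1$; that is, every point of $\partial\Omega$ has a neighbourhood in which $\partial\Omega$ is the graph of a $C^{1,\alpha}$ function of two of the three coordinates, with $\Omega$ on one side of the graph and $\mathbb{R}^3\setminus\overline\Omega$ on the other. Let $v:\partial\Omega\to\mathbb{R}$ be continuous, let $dS$ be the surface area measure on $\partial\Omega$, write $r_{PM}=|P-M|$, and let $$u(M)=\int_{\partial\Omega}\frac{v(P)}{r_{PM}}\,dS_P,\qquad M\in\mathbb{R}^3,$$ be the single-layer potential with density $v$. Then this integral converges absolutely for every $M\in\mathbb{R}^3$, and for every $P_0\in\partial\Omega$ the following holds. There is a unique exterior unit normal vector $n_{P_0}$ to $\partial\Omega$ at $P_0$; the integral $\int_{\partial\Omega}v(P)\,\frac{\partial}{\partial n_{P_0}}\frac{1}{r_{PP_0}}\,dS_P$ converges absolutely, where $\frac{\partial}{\partial n_{P_0}}\frac1{r_{PP_0}}$ is the derivative of $X\mapsto 1/r_{PX}$ at $X=P_0$ in the direction $n_{P_0}$; and the one-sided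 normal derivatives $$\frac{\partial u(P_0)}{\partial n_{P_0}^{+}}=\lim_{t\to0^+}\frac{u(P_0+t\,n_{P_0})-u(P_0)}{t},\qquad \frac{\partial u(P_0)}{\partial n_{P_0}^{-}}=\lim_{t\to0^+}\frac{u(P_0)-u(P_0-t\,n_{P_0})}{t},$$ taken from the exterior and from the interior of $\Omega$ respectively, exist and are given by $$\frac{\partial u(P_0)}{\partial n_{P_0}^{+}}=\int_{\partial\Omega}v(P)\,\frac{\partial}{\partial n_{P_0}}\frac{1}{r_{PP_0}}\,dS_P-2\pi v(P_0),\qquad \frac{\partial u(P_0)}{\partial n_{P_0}^{-}}=\int_{\partial\Omega}v(P)\,\frac{\partial}{\partial n_{P_0}}\frac{1}{r_{PP_0}}\,dS_P+2\pi v(P_0).$$ -/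

import Mathlib

open MeasureTheory Filter Topology

noncomputable section

/-- The projection of a point of `ℝ³` to `ℝ²` that forgets the `i`-th coordinate. -/
def dropCoord (i : Fin 3) (P : EuclideanSpace ℝ (Fin 3)) : EuclideanSpace ℝ (Fin 2) :=
  WithLp.toLp 2 (fun j => P (i.succAbove j))

/-- The boundary of `Ω ⊆ ℝ³` is of class `C^{1,α}`: every boundary point has a neighbourhood in which
the boundary is the graph of a `C^{1,α}` function `f` of two of the three coordinates, with `Ω` on
one side of the graph and the exterior of `Ω` on the other. The sign `s` tells which side is which. -/
def HasC1AlphaBoundary (Ω : Set (EuclideanSpace ℝ (Fin 3))) (α : ℝ) : Prop :=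
  ∀ P₀ ∈ frontier Ω, ∃ δ : ℝ, 0 < δ ∧ ∃ (i : Fin 3) (s : ℝ) (f : EuclideanSpace ℝ (Fin 2) → ℝ),
    (s = 1 ∨ s = -1) ∧
    ContDiffOn ℝ 1 f (Metric.ball (dropCoord i P₀) δ) ∧
    (∃ C : ℝ, ∀ a ∈ Metric.ball (dropCoord i P₀) δ, ∀ b ∈ Metric.ball (dropCoord i P₀) δ,
      ‖fderiv ℝ f a - fderiv ℝ f b‖ ≤ C * ‖a - b‖ ^ α) ∧
    ∀ P ∈ Metric.ball P₀ δ,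
      (P ∈ frontier Ω ↔ P i = f (dropCoord i P)) ∧
      (P ∈ Ω ↔ s * P i < s * f (dropCoord i P)) ∧
      (P ∉ closure Ω ↔ s * f (dropCoord i P) < s * P i)

/-- `n` is an exterior unit normal vector to `∂Ω` at the boundary point `P₀`: a unit vector that is
orthogonal to `∂Ω` at `P₀` (that is, `(P - P₀) · n = o(|P - P₀|)` as `P → P₀` along `∂Ω`) and that
points out of `Ω`, while `-n` points into `Ω`. -/
def IsExteriorUnitNormal (Ω : Set (EuclideanSpace ℝ (Fin 3)))
    (P₀ n : EuclideanSpace ℝ (Fin 3)) : Prop :=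
  ‖n‖ = 1 ∧
  (fun P => inner ℝ (P - P₀) n) =o[𝓝[frontier Ω] P₀] (fun P => P - P₀) ∧
  (∀ᶠ t : ℝ in 𝓝[>] 0, P₀ + t • n ∉ closure Ω) ∧
  (∀ᶠ t : ℝ in 𝓝[>] 0, P₀ - t • n ∈ Ω)

/-- The surface measure `dS` on `∂Ω`: the two-dimensional Hausdorff measure, normalised so as to
agree with area on planes, restricted to `∂Ω`. -/
def surfaceMeasure (Ω : Set (EuclideanSpace ℝ (Fin 3))) : Measure (EuclideanSpace ℝ (Fin 3)) :=
  (μHE[2] : Measure (EuclideanSpace ℝ (Fin 3))).restrict (frontier Ω)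

/-- The single-layer potential `u(M) = ∫_{∂Ω} v(P) / r_{PM} dS_P`. -/
def singleLayer (Ω : Set (EuclideanSpace ℝ (Fin 3))) (v : EuclideanSpace ℝ (Fin 3) → ℝ)
    (M : EuclideanSpace ℝ (Fin 3)) : ℝ :=
  ∫ P, v P / dist P M ∂(surfaceMeasure Ω)

/-- The kernel `∂(1 / r_{PP₀}) / ∂n`: the derivative of `X ↦ 1 / r_{PX}` at `X = P₀` in the
direction `n`. -/
def normalDerivKernel (n P₀ P : EuclideanSpace ℝ (Fin 3)) : ℝ :=
  lineDeriv ℝ (fun X => 1 / dist P X) P₀ n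

/-- `d` is the one-sided derivative of `u` at `P₀` along `n` from the side to which `n` points:
`d = lim (u(M) - u(P₀)) / r_{MP₀}` as `M = P₀ + t n` tends to `P₀` with `t > 0`. -/
def HasExteriorNormalDeriv (u : EuclideanSpace ℝ (Fin 3) → ℝ)
    (P₀ n : EuclideanSpace ℝ (Fin 3)) (d : ℝ) : Prop :=
  Tendsto (fun t : ℝ => (u (P₀ + t • n) - u P₀) / dist (P₀ + t • n) P₀) (𝓝[>] 0) (𝓝 d)

/-- `d` is the one-sided derivative of `u` at `P₀` along `n` from the side opposite to `n`:
`d = lim (u(P₀) - u(M)) / r_{P₀M}` as `M = P₀ - t n` tends to `P₀` with `t > 0`. -/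
def HasInteriorNormalDeriv (u : EuclideanSpace ℝ (Fin 3) → ℝ)
    (P₀ n : EuclideanSpace ℝ (Fin 3)) (d : ℝ) : Prop :=
  Tendsto (fun t : ℝ => (u P₀ - u (P₀ - t • n)) / dist P₀ (P₀ - t • n)) (𝓝[>] 0) (𝓝 d)

end

/-! Put `w = P - P₀` and let `m` be a unit normal at `P₀`. Rationalising the difference quotient of
the Newtonian kernel along `m` gives `(1/|w - t m| - 1/|w|) / t = (2⟨w, m⟩ - t) / (|w| |w - t m|
(|w| + |w - t m|))` (`newton_quotient_eq`), and the two terms of the numerator behave differently as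
`t → 0⁺`.

The term with `2⟨w, m⟩` tends to the normal-derivative kernel `⟨w, m⟩/|w|³`. The `C^{1,α}` boundary
has contact of order `1 + α` with its tangent plane, so this term is dominated by a multiple of
`|w|^(α-2)`, which is integrable on a surface; dominated convergence applies
(`tendsto_integral_regularQuotient`).

The term with `t` is a nonnegative approximate identity of total mass `2π`, and it produces the jump
`2π v(P₀)` (`tendsto_integral_normalPeak`). Its mass is computed explicitly on a disc and carried to
the surface by `exists_planar_comparison`: near `P₀` the projection to the tangent plane is
`1`-Lipschitz with `(1 + η)`-Lipschitz inverse, so Hausdorff measures compare without an area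
formula.

All conditions on `m` are invariant under `m ↦ -m`, so one limit (`tendsto_singleLayer_quotient`)
gives both one-sided derivatives. -/

/-! ### Graph coordinates on `ℝ³`. -/

/-- Forgetting the `i`-th coordinate, as a continuous linear map. -/
noncomputable def dropCoordL (i : Fin 3) :
    EuclideanSpace ℝ (Fin 3) →L[ℝ] EuclideanSpace ℝ (Fin 2) :=
  LinearMap.toContinuousLinearMap
    { toFun := dropCoord i
      map_add' := fun x y => by ext j; simp [dropCoord]
      map_smul' := fun c x => by ext j; simp [dropCoord] }

@[simp] lemma dropCoordL_apply (i : Fin 3) (P : EuclideanSpace ℝ (Fin 3)) :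
    dropCoordL i P = dropCoord i P := rfl

/-- The point of `ℝ³` with `i`-th coordinate `c` and the other coordinates given by `x`. -/
noncomputable def insertCoord (i : Fin 3) :
    (EuclideanSpace ℝ (Fin 2) × ℝ) →L[ℝ] EuclideanSpace ℝ (Fin 3) :=
  LinearMap.toContinuousLinearMap
    { toFun := fun x => WithLp.toLp 2 (i.insertNth x.2 x.1)
      map_add' := fun x y => by
        ext j; refine Fin.succAboveCases i ?_ (fun k => ?_) j <;> simp
      map_smul' := fun c x => by
        ext j; refine Fin.succAboveCases i ?_ (fun k => ?_) j <;> simp }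

@[simp] lemma insertCoord_same (i : Fin 3) (x : EuclideanSpace ℝ (Fin 2) × ℝ) :
    insertCoord i x i = x.2 := by simp [insertCoord]

@[simp] lemma dropCoord_insertCoord (i : Fin 3) (x : EuclideanSpace ℝ (Fin 2) × ℝ) :
    dropCoord i (insertCoord i x) = x.1 := by
  ext j; simp [insertCoord, dropCoord]

lemma insertCoord_dropCoord (i : Fin 3) (P : EuclideanSpace ℝ (Fin 3)) :
    insertCoord i (dropCoord i P, P i) = P := by
  ext j; refine Fin.succAboveCases i ?_ (fun k => ?_) j <;> simp [insertCoord, dropCoord]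

lemma norm_sq_eq_coord_add_dropCoord (i : Fin 3) (P : EuclideanSpace ℝ (Fin 3)) :
    ‖P‖ ^ 2 = (P i) ^ 2 + ‖dropCoord i P‖ ^ 2 := by
  rw [EuclideanSpace.norm_sq_eq, EuclideanSpace.norm_sq_eq, Fin.sum_univ_succAbove _ i]
  simp [dropCoord]

lemma norm_dropCoord_le (i : Fin 3) (P : EuclideanSpace ℝ (Fin 3)) :
    ‖dropCoord i P‖ ≤ ‖P‖ := by
  have := norm_sq_eq_coord_add_dropCoord i P
  exact abs_le_of_sq_le_sq' (by nlinarith [sq_nonneg (P i)]) (norm_nonneg _) |>.2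

lemma dropCoord_sub (i : Fin 3) (P Q : EuclideanSpace ℝ (Fin 3)) :
    dropCoord i (P - Q) = dropCoord i P - dropCoord i Q := (dropCoordL i).map_sub P Q

/-! ### Tangent-plane projections and unit normals. -/

/-- `p` is, up to a linear isometry, the orthogonal projection of `ℝ³` to the plane `m^⊥`. -/
def IsPlaneProjection (m : EuclideanSpace ℝ (Fin 3))
    (p : EuclideanSpace ℝ (Fin 3) →L[ℝ] EuclideanSpace ℝ (Fin 2)) : Prop :=
  ∀ w, ‖w‖ ^ 2 = ‖p w‖ ^ 2 + (inner ℝ w m) ^ 2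

lemma exists_isPlaneProjection {m : EuclideanSpace ℝ (Fin 3)} (hm : ‖m‖ = 1) :
    ∃ p, IsPlaneProjection m p := by
  have hm0 : m ≠ 0 := by rintro rfl; simp at hm
  have : Fact (Module.finrank ℝ (EuclideanSpace ℝ (Fin 3)) = 2 + 1) := ⟨by simp⟩
  let e := (OrthonormalBasis.fromOrthogonalSpanSingleton (𝕜 := ℝ) 2 hm0).repr
  refine ⟨(e.toContinuousLinearEquiv : _ →L[ℝ] _).comp
    ((Submodule.span ℝ {m})ᗮ.orthogonalProjectionOnto), fun w => ?_⟩
  have h1 := Submodule.norm_sq_eq_add_norm_sq_projection w (Submodule.span ℝ {m})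
  have h2 : ‖(Submodule.span ℝ {m}).orthogonalProjectionOnto w‖ = |inner ℝ w m| := by
    rw [← Submodule.norm_coe, Submodule.coe_orthogonalProjectionOnto_apply,
      Submodule.starProjection_unit_singleton ℝ hm, norm_smul, hm, mul_one,
      Real.norm_eq_abs, real_inner_comm]
  rw [h1, h2, sq_abs]
  simp [add_comm]

/-- `m` is a unit normal of the surface `Γ` at `P₀`, where `Γ` is flat near `P₀` in the strict
sense, has contact of order `1 + α` with its tangent plane, and projects onto a neighbourhood in
that plane. -/
structure IsC1AlphaNormal (Γ : Set (EuclideanSpace ℝ (Fin 3))) (α : ℝ)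
    (P₀ m : EuclideanSpace ℝ (Fin 3)) : Prop where
  norm_eq : ‖m‖ = 1
  flat : ∀ ε > 0, ∃ ρ > 0, ∀ P ∈ Γ ∩ Metric.ball P₀ ρ, ∀ Q ∈ Γ ∩ Metric.ball P₀ ρ,
    |inner ℝ (P - Q) m| ≤ ε * ‖P - Q‖
  contact : ∃ C, 0 ≤ C ∧ ∀ P ∈ Γ, |inner ℝ (P - P₀) m| ≤ C * ‖P - P₀‖ ^ (1 + α)
  image_mem_nhds : ∀ p, IsPlaneProjection m p → ∀ ρ > 0,
    p '' (Γ ∩ Metric.ball P₀ ρ) ∈ 𝓝 (p P₀)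

lemma IsC1AlphaNormal.neg {Γ : Set (EuclideanSpace ℝ (Fin 3))} {α : ℝ}
    {P₀ m : EuclideanSpace ℝ (Fin 3)} (h : IsC1AlphaNormal Γ α P₀ m) :
    IsC1AlphaNormal Γ α P₀ (-m) where
  norm_eq := by rw [norm_neg, h.norm_eq]
  flat := by simpa only [inner_neg_right, abs_neg] using h.flat
  contact := by simpa only [inner_neg_right, abs_neg] using h.contact
  image_mem_nhds p hp := h.image_mem_nhds p fun w => by
    simpa only [inner_neg_right, neg_sq] using hp w

/-- Normalise the gradient of `s (x_i - f')`. Its `i`-th component is `±1`, so its norm is at least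
`1`; hence `c ≤ 1`. -/
lemma exists_unit_conormal (i : Fin 3) {s : ℝ} (hs : s = 1 ∨ s = -1)
    (f' : EuclideanSpace ℝ (Fin 2) →L[ℝ] ℝ) :
    ∃ (n : EuclideanSpace ℝ (Fin 3)) (c : ℝ), ‖n‖ = 1 ∧ 0 < c ∧ c ≤ 1 ∧
      ∀ w, inner ℝ w n = c * (s * (w i - f' (dropCoord i w))) := by
  let l : EuclideanSpace ℝ (Fin 3) →L[ℝ] ℝ :=
    s • (EuclideanSpace.proj i - f'.comp (dropCoordL i))
  let N := (InnerProductSpace.toDual ℝ (EuclideanSpace ℝ (Fin 3))).symm l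
  have hN : ∀ w, inner ℝ w N = s * (w i - f' (dropCoord i w)) := fun w => by
    rw [real_inner_comm, InnerProductSpace.toDual_symm_apply]; simp [l]
  let e := insertCoord i (0, 1)
  have he : ‖e‖ = 1 := by
    have := norm_sq_eq_coord_add_dropCoord i e
    simp only [e, insertCoord_same, dropCoord_insertCoord, norm_zero] at this
    exact (sq_eq_sq₀ (norm_nonneg _) zero_le_one).1 (by simpa using this)
  have h1 : 1 ≤ ‖N‖ := by
    have h2 : inner ℝ e N = s := by rw [hN]; simp [e]
    have h3 := abs_real_inner_le_norm e N
    rw [h2, he, one_mul] at h3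
    rcases hs with rfl | rfl <;> simpa using h3
  have h0 : 0 < ‖N‖ := by linarith
  refine ⟨‖N‖⁻¹ • N, ‖N‖⁻¹, ?_, inv_pos.2 h0, inv_le_one_of_one_le₀ h1, fun w => ?_⟩
  · rw [norm_smul, norm_inv, norm_norm, inv_mul_cancel₀ h0.ne']
  · rw [real_inner_smul_right, hN]

/-! ### The boundary as a local graph. -/

/-- In the ball `B(P₀, δ)` the set `Ω` lies on one side of the graph `x_i = f`. -/
structure IsLocalGraph (Ω : Set (EuclideanSpace ℝ (Fin 3))) (α : ℝ)
    (P₀ : EuclideanSpace ℝ (Fin 3)) (δ : ℝ) (i : Fin 3) (s : ℝ)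
    (f : EuclideanSpace ℝ (Fin 2) → ℝ) : Prop where
  mem : P₀ ∈ frontier Ω
  pos : 0 < δ
  sign : s = 1 ∨ s = -1
  contDiffOn : ContDiffOn ℝ 1 f (Metric.ball (dropCoord i P₀) δ)
  holder : ∃ C : ℝ, ∀ a ∈ Metric.ball (dropCoord i P₀) δ, ∀ b ∈ Metric.ball (dropCoord i P₀) δ,
      ‖fderiv ℝ f a - fderiv ℝ f b‖ ≤ C * ‖a - b‖ ^ α
  sides : ∀ P ∈ Metric.ball P₀ δ,
      (P ∈ frontier Ω ↔ P i = f (dropCoord i P)) ∧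
      (P ∈ Ω ↔ s * P i < s * f (dropCoord i P)) ∧
      (P ∉ closure Ω ↔ s * f (dropCoord i P) < s * P i)

namespace IsLocalGraph

variable {Ω : Set (EuclideanSpace ℝ (Fin 3))} {α : ℝ} {P₀ : EuclideanSpace ℝ (Fin 3)} {δ : ℝ}
  {i : Fin 3} {s : ℝ} {f : EuclideanSpace ℝ (Fin 2) → ℝ}

lemma eq_apply (h : IsLocalGraph Ω α P₀ δ i s f) : P₀ i = f (dropCoord i P₀) :=
  ((h.sides P₀ (Metric.mem_ball_self h.pos)).1).1 h.mem

lemma hasStrictFDerivAt (h : IsLocalGraph Ω α P₀ δ i s f) :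
    HasStrictFDerivAt f (fderiv ℝ f (dropCoord i P₀)) (dropCoord i P₀) :=
  (h.contDiffOn.contDiffAt (Metric.ball_mem_nhds _ h.pos)).hasStrictFDerivAt one_ne_zero

lemma dropCoord_mem_ball {ρ : ℝ} {P : EuclideanSpace ℝ (Fin 3)}
    (hP : P ∈ Metric.ball P₀ ρ) : dropCoord i P ∈ Metric.ball (dropCoord i P₀) ρ := by
  rw [Metric.mem_ball, dist_eq_norm] at *
  rw [← dropCoord_sub]
  exact (norm_dropCoord_le _ _).trans_lt hP

lemma coord_sub_eq (h : IsLocalGraph Ω α P₀ δ i s f) {P Q : EuclideanSpace ℝ (Fin 3)}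
    (hP : P ∈ frontier Ω ∩ Metric.ball P₀ δ) (hQ : Q ∈ frontier Ω ∩ Metric.ball P₀ δ) :
    (P - Q) i = f (dropCoord i P) - f (dropCoord i Q) := by
  rw [PiLp.sub_apply, ((h.sides P hP.2).1).1 hP.1, ((h.sides Q hQ.2).1).1 hQ.1]

/-- Strict differentiability is what lets both `P` and `Q` vary; this later makes the inverse of the
tangent-plane projection Lipschitz. -/
lemma flat (h : IsLocalGraph Ω α P₀ δ i s f) {ε : ℝ} (hε : 0 < ε) :
    ∃ ρ > 0, ∀ P ∈ frontier Ω ∩ Metric.ball P₀ ρ, ∀ Q ∈ frontier Ω ∩ Metric.ball P₀ ρ,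
      |(P - Q) i - fderiv ℝ f (dropCoord i P₀) (dropCoord i (P - Q))| ≤ ε * ‖P - Q‖ := by
  have h1 := h.hasStrictFDerivAt.isLittleO.def hε
  have hc : Tendsto (fun q : EuclideanSpace ℝ (Fin 3) × EuclideanSpace ℝ (Fin 3) =>
      (dropCoord i q.1, dropCoord i q.2)) (𝓝 (P₀, P₀)) (𝓝 (dropCoord i P₀, dropCoord i P₀)) :=
    (((dropCoordL i).continuous.comp continuous_fst).prodMk
      ((dropCoordL i).continuous.comp continuous_snd)).tendsto (P₀, P₀)
  obtain ⟨ρ, hρ, h2⟩ := Metric.eventually_nhds_iff_ball.1 (hc.eventually h1)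
  refine ⟨min ρ δ, lt_min hρ h.pos, fun P hP Q hQ => ?_⟩
  have hsub : ∀ R ∈ frontier Ω ∩ Metric.ball P₀ (min ρ δ), R ∈ frontier Ω ∩ Metric.ball P₀ δ :=
    fun R hR => ⟨hR.1, Metric.ball_subset_ball (min_le_right _ _) hR.2⟩
  rw [h.coord_sub_eq (hsub P hP) (hsub Q hQ), dropCoord_sub]
  have h3 := h2 (P, Q) (by
    rw [← ball_prod_same]
    exact ⟨Metric.ball_subset_ball (min_le_left _ _) hP.2,
      Metric.ball_subset_ball (min_le_left _ _) hQ.2⟩)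
  simp only [Real.norm_eq_abs, ← dropCoord_sub] at h3 ⊢
  exact h3.trans (mul_le_mul_of_nonneg_left (norm_dropCoord_le _ _) hε.le)

/-- Mean value inequality on the segment between the projected points, where Hölder continuity
bounds the variation of `f'`. -/
lemma contact_near (h : IsLocalGraph Ω α P₀ δ i s f) (hα : 0 < α) :
    ∃ C, 0 ≤ C ∧ ∀ P ∈ frontier Ω ∩ Metric.ball P₀ δ,
      |(P - P₀) i - fderiv ℝ f (dropCoord i P₀) (dropCoord i (P - P₀))| ≤
        C * ‖P - P₀‖ ^ (1 + α) := by
  obtain ⟨C, hC⟩ := h.holder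
  refine ⟨|C|, abs_nonneg _, fun P hP => ?_⟩
  have hmem0 : P₀ ∈ frontier Ω ∩ Metric.ball P₀ δ := ⟨h.mem, Metric.mem_ball_self h.pos⟩
  rw [h.coord_sub_eq hP hmem0, dropCoord_sub]
  set a := dropCoord i P₀ with ha
  set b := dropCoord i P with hb
  have hab : ‖b - a‖ ≤ ‖P - P₀‖ := by
    rw [ha, hb, ← dropCoord_sub]; exact norm_dropCoord_le _ _
  have hbδ : b ∈ Metric.ball a δ := dropCoord_mem_ball hP.2
  have haδ : a ∈ Metric.ball a δ := Metric.mem_ball_self h.pos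
  have hsub : segment ℝ a b ⊆ Metric.ball a δ := (convex_ball a δ).segment_subset haδ hbδ
  have key := (convex_segment (𝕜 := ℝ) a b).norm_image_sub_le_of_norm_fderiv_le' (f := f)
    (φ := fderiv ℝ f a) (C := |C| * ‖P - P₀‖ ^ α) (x := a) (y := b)
    (fun x hx => (h.contDiffOn.contDiffAt
      (Metric.isOpen_ball.mem_nhds (hsub hx))).differentiableAt one_ne_zero)
    (fun x hx => by
      refine (hC x (hsub hx) a haδ).trans ?_
      have : ‖x - a‖ ≤ ‖P - P₀‖ := (norm_sub_le_of_mem_segment hx).trans hab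
      exact mul_le_mul (le_abs_self C) (Real.rpow_le_rpow (norm_nonneg _) this hα.le)
        (by positivity) (abs_nonneg _)) (left_mem_segment ..) (right_mem_segment ..)
  rw [Real.norm_eq_abs] at key
  refine key.trans ?_
  have h0 : ‖P - P₀‖ ^ (1 + α) = ‖P - P₀‖ ^ α * ‖P - P₀‖ := by
    rw [add_comm, Real.rpow_add_one' (norm_nonneg _) (by positivity)]
  rw [h0, ← mul_assoc]
  gcongr

/-- The local parametrisation of the boundary by the graph coordinates. -/
noncomputable def param (i : Fin 3) (f : EuclideanSpace ℝ (Fin 2) → ℝ)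
    (x : EuclideanSpace ℝ (Fin 2)) : EuclideanSpace ℝ (Fin 3) := insertCoord i (x, f x)

/-- The derivative of the local parametrisation. -/
noncomputable def paramDeriv (i : Fin 3) (f' : EuclideanSpace ℝ (Fin 2) →L[ℝ] ℝ) :
    EuclideanSpace ℝ (Fin 2) →L[ℝ] EuclideanSpace ℝ (Fin 3) :=
  (insertCoord i).comp ((ContinuousLinearMap.id ℝ _).prod f')

lemma param_self (h : IsLocalGraph Ω α P₀ δ i s f) : param i f (dropCoord i P₀) = P₀ := by
  rw [param, ← h.eq_apply, insertCoord_dropCoord]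

lemma hasStrictFDerivAt_param (h : IsLocalGraph Ω α P₀ δ i s f) :
    HasStrictFDerivAt (param i f) (paramDeriv i (fderiv ℝ f (dropCoord i P₀)))
      (dropCoord i P₀) :=
  (insertCoord i).hasStrictFDerivAt.comp _ ((hasStrictFDerivAt_id _).prodMk h.hasStrictFDerivAt)

lemma tendsto_param (h : IsLocalGraph Ω α P₀ δ i s f) :
    Tendsto (param i f) (𝓝 (dropCoord i P₀)) (𝓝[frontier Ω] P₀) := by
  have h1 : Tendsto (param i f) (𝓝 (dropCoord i P₀)) (𝓝 P₀) := by
    simpa only [ContinuousAt, h.param_self] using h.hasStrictFDerivAt_param.continuousAt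
  refine tendsto_nhdsWithin_iff.2 ⟨h1, ?_⟩
  filter_upwards [h1 (Metric.ball_mem_nhds _ h.pos)] with x hx
  refine ((h.sides _ hx).1).2 ?_
  simp [param]

/-- A tangent vector killed by `p` is also orthogonal to `n`, hence zero. So `p` composed with the
parametrisation has invertible strict derivative and is open at the base point. -/
lemma image_mem_nhds (h : IsLocalGraph Ω α P₀ δ i s f) {n : EuclideanSpace ℝ (Fin 3)} {c : ℝ}
    (hn : ∀ w, inner ℝ w n = c * (s * (w i - fderiv ℝ f (dropCoord i P₀) (dropCoord i w))))
    {p : EuclideanSpace ℝ (Fin 3) →L[ℝ] EuclideanSpace ℝ (Fin 2)} (hp : IsPlaneProjection n p)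
    {ρ : ℝ} (hρ : 0 < ρ) : p '' (frontier Ω ∩ Metric.ball P₀ ρ) ∈ 𝓝 (p P₀) := by
  have h1 := p.hasStrictFDerivAt.comp _ h.hasStrictFDerivAt_param
  have hinj : Function.Injective
      ((p.comp (paramDeriv i (fderiv ℝ f (dropCoord i P₀)))) :
        EuclideanSpace ℝ (Fin 2) →ₗ[ℝ] EuclideanSpace ℝ (Fin 2)) := by
    refine (injective_iff_map_eq_zero _).2 fun y hy => ?_
    have h2 := hp (paramDeriv i (fderiv ℝ f (dropCoord i P₀)) y)
    have h3 : p (paramDeriv i (fderiv ℝ f (dropCoord i P₀)) y) = 0 := hy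
    rw [h3, hn] at h2
    have h4 : paramDeriv i (fderiv ℝ f (dropCoord i P₀)) y = 0 := by
      simpa [paramDeriv] using h2
    have h5 := congrArg (dropCoordL i) h4
    rw [map_zero] at h5
    simpa [paramDeriv] using h5
  have h6 := h1.map_nhds_eq_of_surj
    (LinearMap.range_eq_top.2 (LinearMap.injective_iff_surjective.1 hinj))
  rw [h.param_self] at h6
  rw [← h6]
  have h8 : frontier Ω ∩ Metric.ball P₀ ρ ∈ 𝓝[frontier Ω] P₀ :=
    inter_mem self_mem_nhdsWithin (mem_nhdsWithin_of_mem_nhds (Metric.ball_mem_nhds _ hρ))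
  rw [mem_map]
  filter_upwards [mem_map.1 (h.tendsto_param h8)] with x hx
  exact ⟨_, hx, rfl⟩

/-- The defining function `s (x_i - f)` vanishes at `P₀` and has positive derivative along `n`. -/
lemma eventually_sides (h : IsLocalGraph Ω α P₀ δ i s f) {n : EuclideanSpace ℝ (Fin 3)}
    (hn : 0 < s * (n i - fderiv ℝ f (dropCoord i P₀) (dropCoord i n))) :
    (∀ᶠ t : ℝ in 𝓝[>] 0, P₀ + t • n ∉ closure Ω) ∧ (∀ᶠ t : ℝ in 𝓝[>] 0, P₀ - t • n ∈ Ω) := by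
  let g : ℝ → ℝ := fun t =>
    s * ((P₀ + t • n) i - f (dropCoord i (P₀ + t • n)))
  have hline : HasDerivAt (fun t : ℝ => P₀ + t • n) n 0 := by
    simpa using ((hasDerivAt_id (0 : ℝ)).smul_const n).const_add P₀
  have hg : HasDerivAt g (s * (n i - fderiv ℝ f (dropCoord i P₀) (dropCoord i n))) 0 := by
    have h1 : HasDerivAt (fun t : ℝ => (P₀ + t • n) i) (n i) 0 :=
      (EuclideanSpace.proj (𝕜 := ℝ) i).hasFDerivAt.comp_hasDerivAt (0 : ℝ) hline
    have h2 : HasDerivAt (fun t : ℝ => dropCoordL i (P₀ + t • n)) (dropCoordL i n) 0 :=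
      (dropCoordL i).hasFDerivAt.comp_hasDerivAt (0 : ℝ) hline
    have h3 : HasFDerivAt f (fderiv ℝ f (dropCoord i P₀))
        (dropCoordL i (P₀ + (0 : ℝ) • n)) := by
      simpa using h.hasStrictFDerivAt.hasFDerivAt
    exact (h1.sub (h3.comp_hasDerivAt (0 : ℝ) h2)).const_mul s
  have hg0 : g 0 = 0 := by simp [g, h.eq_apply]
  have hpos : ∀ᶠ t in 𝓝[≠] (0 : ℝ), 0 < t⁻¹ * g t := by
    have := (hasDerivAt_iff_tendsto_slope.1 hg).eventually (lt_mem_nhds hn)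
    simpa [slope_def_field, hg0, div_eq_inv_mul] using this
  have hball : ∀ᶠ t in 𝓝 (0 : ℝ), P₀ + t • n ∈ Metric.ball P₀ δ := by
    refine hline.continuousAt.eventually (Metric.isOpen_ball.mem_nhds ?_)
    simpa using h.pos
  have hneg : Tendsto (fun t : ℝ => -t) (𝓝[>] 0) (𝓝[<] 0) := by
    simpa using tendsto_neg_nhdsGT (a := (0 : ℝ))
  constructor
  · filter_upwards [hpos.filter_mono (nhdsGT_le_nhdsNE 0), hball.filter_mono nhdsWithin_le_nhds,
      self_mem_nhdsWithin] with t h1 h2 h3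
    refine ((h.sides _ h2).2.2).2 ?_
    have := (mul_pos_iff_of_pos_left (inv_pos.2 h3)).1 h1
    simp only [g] at this
    linarith
  · filter_upwards [hneg (hpos.filter_mono (nhdsLT_le_nhdsNE 0)),
      hneg (hball.filter_mono nhdsWithin_le_nhds), self_mem_nhdsWithin] with t h1 h2 h3
    have h4 : P₀ - t • n = P₀ + (-t) • n := by rw [neg_smul, sub_eq_add_neg]
    rw [h4]
    refine ((h.sides _ h2).2.1).2 ?_
    have h5 : 0 < (-t)⁻¹ * g (-t) := h1
    have h6 : g (-t) < 0 := by
      have h7 : (-t)⁻¹ < 0 := inv_lt_zero.2 (neg_lt_zero.2 h3)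
      by_contra! h8
      nlinarith
    simp only [g] at h6
    linarith

/-- The height `⟨param x - P₀, m⟩` has derivative zero by the little-o condition and `⟨paramDeriv ·,
m⟩` by the chain rule; `w` is in the range of `paramDeriv`. -/
lemma inner_eq_zero_of_isLittleO (h : IsLocalGraph Ω α P₀ δ i s f)
    {m : EuclideanSpace ℝ (Fin 3)}
    (hm : (fun P => inner ℝ (P - P₀) m) =o[𝓝[frontier Ω] P₀] (fun P => P - P₀))
    {w : EuclideanSpace ℝ (Fin 3)} (hw : w i = fderiv ℝ f (dropCoord i P₀) (dropCoord i w)) :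
    inner ℝ w m = 0 := by
  have h1 := h.hasStrictFDerivAt_param.hasFDerivAt
  have h2 : HasFDerivAt (fun x => inner ℝ (param i f x - P₀) m)
      (0 : EuclideanSpace ℝ (Fin 2) →L[ℝ] ℝ) (dropCoord i P₀) := by
    rw [hasFDerivAt_iff_isLittleO]
    have h3 := (hm.comp_tendsto h.tendsto_param).trans_isBigO
      (by simpa [Function.comp_def, h.param_self] using h1.isBigO_sub)
    simpa [Function.comp_def, h.param_self] using h3
  have h4 : HasFDerivAt (fun x => inner ℝ (param i f x - P₀) m)
      ((innerSL ℝ m).comp (paramDeriv i (fderiv ℝ f (dropCoord i P₀)))) (dropCoord i P₀) := by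
    have := ((innerSL ℝ m).hasFDerivAt.comp _ (h1.sub_const P₀))
    refine this.congr_of_eventuallyEq (.of_forall fun x => ?_)
    simp [real_inner_comm]
  have h5 := congrArg (fun l => l (dropCoord i w)) (h4.unique h2)
  have h6 : paramDeriv i (fderiv ℝ f (dropCoord i P₀)) (dropCoord i w) = w := by
    simp only [paramDeriv, ContinuousLinearMap.comp_apply, ContinuousLinearMap.prod_apply, ← hw]
    exact insertCoord_dropCoord i w
  rw [ContinuousLinearMap.comp_apply, h6] at h5
  simpa [real_inner_comm] using h5

end IsLocalGraph

theorem HasC1AlphaBoundary.exists_normal {Ω : Set (EuclideanSpace ℝ (Fin 3))} {α : ℝ}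
    (hΩ : HasC1AlphaBoundary Ω α) (hα : 0 < α) {P₀ : EuclideanSpace ℝ (Fin 3)} (hP₀ : P₀ ∈ frontier Ω) :
    ∃ n, IsExteriorUnitNormal Ω P₀ n ∧ (∀ m, IsExteriorUnitNormal Ω P₀ m → m = n) ∧
      IsC1AlphaNormal (frontier Ω) α P₀ n := by
  obtain ⟨δ, hδ, i, s, f, hs, hf, hhol, hsides⟩ := hΩ P₀ hP₀
  have h : IsLocalGraph Ω α P₀ δ i s f := ⟨hP₀, hδ, hs, hf, hhol, hsides⟩
  obtain ⟨n, c, hn, hc, hc1, hin⟩ := exists_unit_conormal i hs (fderiv ℝ f (dropCoord i P₀))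
  have habs : ∀ w, |inner ℝ w n| ≤ |w i - fderiv ℝ f (dropCoord i P₀) (dropCoord i w)| := by
    intro w
    have h1 : |s| = 1 := by rcases hs with rfl | rfl <;> simp
    rw [hin, abs_mul, abs_mul, h1, one_mul, abs_of_pos hc]
    exact mul_le_of_le_one_left (abs_nonneg _) hc1
  have hflat : ∀ ε > 0, ∃ ρ > 0, ∀ P ∈ frontier Ω ∩ Metric.ball P₀ ρ,
      ∀ Q ∈ frontier Ω ∩ Metric.ball P₀ ρ, |inner ℝ (P - Q) n| ≤ ε * ‖P - Q‖ := fun ε hε => by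
    obtain ⟨ρ, hρ, h1⟩ := h.flat hε
    exact ⟨ρ, hρ, fun P hP Q hQ => (habs _).trans (h1 P hP Q hQ)⟩
  have hnn : inner ℝ n n = (1 : ℝ) := by rw [real_inner_self_eq_norm_sq, hn]; norm_num
  have hpos : 0 < s * (n i - fderiv ℝ f (dropCoord i P₀) (dropCoord i n)) := by
    have h1 := hin n
    rw [hnn] at h1
    exact (mul_pos_iff_of_pos_left hc).1 (by rw [← h1]; exact one_pos)
  obtain ⟨hout, hinn⟩ := h.eventually_sides hpos
  refine ⟨n, ⟨hn, ?_, hout, hinn⟩, fun m hm => ?_, hn, hflat, ?_, fun p hp ρ hρ =>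
    h.image_mem_nhds hin hp hρ⟩
  · refine Asymptotics.IsLittleO.of_bound fun ε hε => ?_
    obtain ⟨ρ, hρ, h1⟩ := hflat ε hε
    filter_upwards [self_mem_nhdsWithin,
      mem_nhdsWithin_of_mem_nhds (Metric.ball_mem_nhds P₀ hρ)] with P h2 h3
    exact h1 P ⟨h2, h3⟩ P₀ ⟨hP₀, Metric.mem_ball_self hρ⟩
  -- The component of `m` orthogonal to `n` is tangent, hence orthogonal to `m`; this forces `⟨m,
  -- n⟩² = 1`. The case `m = -n` would put points of `Ω` outside its closure.
  · obtain ⟨hm1, hm2, hm3, hm4⟩ := hm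
    have hs0 : s ≠ 0 := by rcases hs with rfl | rfl <;> norm_num
    have h1 := h.inner_eq_zero_of_isLittleO hm2 (w := m - (inner ℝ m n : ℝ) • n) (by
      have h2 := hin (m - (inner ℝ m n : ℝ) • n)
      rw [inner_sub_left, real_inner_smul_left, hnn, mul_one, sub_self, eq_comm, mul_eq_zero,
        mul_eq_zero] at h2
      exact sub_eq_zero.1 ((h2.resolve_left hc.ne').resolve_left hs0))
    rw [inner_sub_left, real_inner_smul_left, real_inner_self_eq_norm_sq, hm1,
      real_inner_comm m n] at h1
    have h3 : (inner ℝ m n - 1 : ℝ) * (inner ℝ m n + 1) = 0 := by linarith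
    rcases mul_eq_zero.1 h3 with h4 | h4
    · exact (inner_eq_one_iff_of_norm_eq_one (𝕜 := ℝ) hm1 hn).1 (by linarith)
    · have h5 : m = -n := by
        have : inner ℝ m (-n) = (1 : ℝ) := by rw [inner_neg_right]; linarith
        exact (inner_eq_one_iff_of_norm_eq_one (𝕜 := ℝ) hm1 (by rw [norm_neg, hn])).1 this
      obtain ⟨t, h6, h7⟩ := (hm3.and hinn).exists
      rw [h5, smul_neg, ← sub_eq_add_neg] at h6
      exact absurd (subset_closure h7) h6
  · obtain ⟨C, hC, h1⟩ := h.contact_near hα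
    have h2 : 0 < δ ^ (-α) := Real.rpow_pos_of_pos hδ _
    -- Away from the graph ball `‖P - P₀‖ ≥ δ`, so `‖P - P₀‖ ≤ δ^(-α) ‖P - P₀‖^(1+α)`: the second
    -- constant makes the bound global.
    refine ⟨C + δ ^ (-α), by positivity, fun P hP => ?_⟩
    have h3 : 0 ≤ ‖P - P₀‖ ^ (1 + α) := by positivity
    by_cases h4 : P ∈ Metric.ball P₀ δ
    · refine (habs _).trans ((h1 P ⟨hP, h4⟩).trans ?_)
      gcongr
      linarith
    · rw [Metric.mem_ball, dist_eq_norm, not_lt] at h4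
      have h5 := abs_real_inner_le_norm (P - P₀) n
      rw [hn, mul_one] at h5
      have h6 : δ ^ α ≤ ‖P - P₀‖ ^ α := Real.rpow_le_rpow hδ.le h4 hα.le
      have h7 : δ ^ (-α) * ‖P - P₀‖ ^ (1 + α) ≤
          (C + δ ^ (-α)) * ‖P - P₀‖ ^ (1 + α) := by gcongr; linarith
      refine h5.trans (le_trans ?_ h7)
      have h8 : 0 < ‖P - P₀‖ := hδ.trans_le h4
      rw [Real.rpow_add h8, Real.rpow_one, Real.rpow_neg hδ.le]
      have h9 : 0 < δ ^ α := Real.rpow_pos_of_pos hδ _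
      rw [← div_eq_inv_mul, le_div_iff₀ h9]
      gcongr

/-! ### Hausdorff measure and integrals under bi-Lipschitz maps. -/

section HausdorffComparison

open scoped NNReal ENNReal

variable {X Y : Type*} [EMetricSpace X] [MeasurableSpace X] [BorelSpace X]
  [EMetricSpace Y] [MeasurableSpace Y] [BorelSpace Y]

lemma LipschitzOnWith.euclideanHausdorffMeasure_image_le {f : X → Y} {K : ℝ≥0} {A : Set X}
    (hf : LipschitzOnWith K f A) (d : ℕ) : μHE[d] (f '' A) ≤ (K : ℝ≥0∞) ^ d * μHE[d] A := by
  simp_rw [Measure.euclideanHausdorffMeasure_def, Measure.smul_apply, ENNReal.smul_def,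
    smul_eq_mul]
  rw [mul_left_comm]
  gcongr
  simpa using hf.hausdorffMeasure_image_le (d := d) d.cast_nonneg

lemma euclideanHausdorffMeasure_le_of_edist_le [Nonempty X] {f : X → Y} {K : ℝ≥0} {A : Set X}
    (hf : ∀ x ∈ A, ∀ y ∈ A, edist x y ≤ K * edist (f x) (f y)) (d : ℕ) :
    μHE[d] A ≤ (K : ℝ≥0∞) ^ d * μHE[d] (f '' A) := by
  have hinj : Set.InjOn f A := fun x hx y hy hxy => by
    have := hf x hx y hy
    rw [hxy, edist_self, mul_zero] at this
    exact edist_le_zero.1 this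
  have hinv := hinj.leftInvOn_invFunOn
  have hlip : LipschitzOnWith K (Function.invFunOn f A) (f '' A) := by
    rintro _ ⟨x, hx, rfl⟩ _ ⟨y, hy, rfl⟩
    rw [hinv hx, hinv hy]
    exact hf x hx y hy
  simpa [hinv.image_image] using hlip.euclideanHausdorffMeasure_image_le d

variable {S : Set X} {q : X → Y} {g : Y → ℝ≥0∞} {D : Set Y}

/-- Both sides are integrals of `g`, so it suffices to compare the pushforward measure with the
target measure on measurable sets. -/
lemma setLIntegral_comp_le_of_edist_le [Nonempty X] (hq : Measurable q) {K : ℝ≥0}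
    (hK : ∀ x ∈ S, ∀ y ∈ S, edist x y ≤ K * edist (q x) (q y)) (d : ℕ) (hg : Measurable g)
    (hD : q '' S ⊆ D) :
    ∫⁻ x in S, g (q x) ∂μHE[d] ≤ (K : ℝ≥0∞) ^ d * ∫⁻ y in D, g y ∂μHE[d] := by
  rw [← lintegral_map hg hq, ← smul_eq_mul, ← lintegral_smul_measure]
  refine lintegral_mono' (Measure.le_iff.2 fun B hB => ?_) le_rfl
  rw [Measure.map_apply hq hB, Measure.restrict_apply (hq hB), Measure.smul_apply, smul_eq_mul,
    Measure.restrict_apply hB]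
  refine (euclideanHausdorffMeasure_le_of_edist_le
    (fun x hx y hy => hK x hx.2 y hy.2) d).trans ?_
  gcongr
  rintro _ ⟨x, hx, rfl⟩
  exact ⟨hx.1, hD ⟨x, hx.2, rfl⟩⟩

lemma setLIntegral_le_setLIntegral_comp (hq : Measurable q)
    (hlip : LipschitzOnWith 1 q S) (d : ℕ) (hg : Measurable g) (hD : D ⊆ q '' S) :
    ∫⁻ y in D, g y ∂μHE[d] ≤ ∫⁻ x in S, g (q x) ∂μHE[d] := by
  rw [← lintegral_map hg hq]
  refine lintegral_mono' (Measure.le_iff.2 fun B hB => ?_) le_rfl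
  rw [Measure.map_apply hq hB, Measure.restrict_apply (hq hB), Measure.restrict_apply hB]
  have h1 : B ∩ D ⊆ q '' (q ⁻¹' B ∩ S) := by
    rintro y ⟨hy, hyD⟩
    obtain ⟨x, hx, rfl⟩ := hD hyD
    exact ⟨x, ⟨hy, hx⟩, rfl⟩
  refine (measure_mono h1).trans ?_
  simpa using (hlip.mono Set.inter_subset_right).euclideanHausdorffMeasure_image_le d

end HausdorffComparison

/-! ### Radial integrals over discs. -/

section PlanarIntegrals

lemma setIntegral_ball_fun_norm (f : ℝ → ℝ) (ρ : ℝ) :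
    ∫ x in Metric.ball (0 : EuclideanSpace ℝ (Fin 2)) ρ, f ‖x‖ =
      2 * Real.pi * ∫ y in Set.Ioo 0 ρ, y * f y := by
  have h1 : (Metric.ball (0 : EuclideanSpace ℝ (Fin 2)) ρ).indicator (fun x => f ‖x‖) =
      fun x => (Set.Iio ρ).indicator f ‖x‖ := by
    ext x
    by_cases hx : ‖x‖ < ρ <;> simp [hx]
  rw [← integral_indicator measurableSet_ball, h1,
    integral_fun_norm_addHaar volume ((Set.Iio ρ).indicator f)]
  have h2 : (fun y : ℝ => y * (Set.Iio ρ).indicator f y) =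
      (Set.Iio ρ).indicator (fun y => y * f y) := by
    ext y; simp [Set.indicator_apply]
  simp [measureReal_def, h2, setIntegral_indicator measurableSet_Iio, Set.Ioi_inter_Iio,
    mul_assoc, nsmul_eq_mul, Real.pi_nonneg]

lemma setLIntegral_ball_rpow_lt_top {β : ℝ} (hβ : β < 2) (ρ : ℝ) :
    ∫⁻ x in Metric.ball (0 : EuclideanSpace ℝ (Fin 2)) ρ, ENNReal.ofReal (‖x‖ ^ (-β)) < ⊤ := by
  rcases le_or_gt ρ 0 with hρ | hρ
  · simp [Metric.ball_eq_empty.2 hρ]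
  have h1 : IntegrableOn (fun x : EuclideanSpace ℝ (Fin 2) => ‖x‖ ^ (-β))
      (Metric.ball 0 ρ) := by
    refine (integrableOn_fun_norm_addHaar volume (f := fun y : ℝ => y ^ (-β))).2 ?_
    have h2 : IntegrableOn (fun y : ℝ => y ^ (1 - β)) (Set.Ioo 0 ρ) :=
      (intervalIntegral.integrableOn_Ioo_rpow_iff hρ).2 (by linarith)
    refine h2.congr_fun (fun y hy => ?_) measurableSet_Ioo
    simp [sub_eq_add_neg, Real.rpow_add hy.1]
  exact Integrable.lintegral_lt_top h1

/-- The radial profile of the kernel `t / (r |x - t m| (r + |x - t m|))` on the plane `m^⊥`. -/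
noncomputable def planarPeak (t r : ℝ) : ℝ :=
  t / (r * √(r ^ 2 + t ^ 2) * (r + √(r ^ 2 + t ^ 2)))

lemma planarPeak_nonneg {t r : ℝ} (ht : 0 ≤ t) (hr : 0 ≤ r) : 0 ≤ planarPeak t r := by
  unfold planarPeak; positivity

lemma measurable_planarPeak (t : ℝ) : Measurable (planarPeak t) := by
  unfold planarPeak; fun_prop

lemma mul_planarPeak {t r : ℝ} (ht : 0 < t) (hr : 0 < r) :
    r * planarPeak t r = (1 - r / √(r ^ 2 + t ^ 2)) / t := by
  unfold planarPeak
  have h1 : 0 < √(r ^ 2 + t ^ 2) := Real.sqrt_pos.2 (by positivity)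
  have h2 := Real.sq_sqrt (show 0 ≤ r ^ 2 + t ^ 2 by positivity)
  set s := √(r ^ 2 + t ^ 2)
  field_simp
  nlinarith

/-- In polar coordinates the integrand is `(1 - r/√(r² + t²))/t`, with primitive `(r - √(r² +
t²))/t`. -/
lemma setLIntegral_ball_planarPeak {t ρ : ℝ} (ht : 0 < t) (hρ : 0 < ρ) :
    ∫⁻ x in Metric.ball (0 : EuclideanSpace ℝ (Fin 2)) ρ, ENNReal.ofReal (planarPeak t ‖x‖) =
      ENNReal.ofReal (2 * Real.pi * (1 + (ρ - √(ρ ^ 2 + t ^ 2)) / t)) := by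
  have hpos : ∀ r : ℝ, 0 < r ^ 2 + t ^ 2 := fun r => by positivity
  have hcont : Continuous fun r : ℝ => (1 - r / √(r ^ 2 + t ^ 2)) / t := by
    have : ∀ r : ℝ, √(r ^ 2 + t ^ 2) ≠ 0 := fun r => (Real.sqrt_pos.2 (hpos r)).ne'
    fun_prop (disch := assumption)
  have hint : IntegrableOn (fun r => r * planarPeak t r) (Set.Ioo 0 ρ) :=
    ((hcont.integrableOn_Icc (a := 0) (b := ρ)).mono_set Set.Ioo_subset_Icc_self).congr_fun
      (fun r hr => (mul_planarPeak ht hr.1).symm) measurableSet_Ioo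
  have hval : ∫ r in Set.Ioo 0 ρ, r * planarPeak t r = 1 + (ρ - √(ρ ^ 2 + t ^ 2)) / t := by
    rw [setIntegral_congr_fun measurableSet_Ioo
      (fun r hr => mul_planarPeak ht hr.1), ← integral_Ioc_eq_integral_Ioo,
      ← intervalIntegral.integral_of_le hρ.le,
      intervalIntegral.integral_eq_sub_of_hasDerivAt
        (f := fun r => (r - √(r ^ 2 + t ^ 2)) / t) (fun r _ => ?_)
        (hcont.intervalIntegrable _ _)]
    · simp [Real.sqrt_sq ht.le]
      field_simp
      ring
    · have h1 : HasDerivAt (fun r : ℝ => r ^ 2 + t ^ 2) (2 * r) r := by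
        simpa using ((hasDerivAt_id r).pow 2).add_const (t ^ 2)
      have h2 := (((hasDerivAt_id r).sub (h1.sqrt (hpos r).ne')).div_const t)
      refine h2.congr_deriv ?_
      rw [mul_div_mul_left _ _ (two_ne_zero)]
  rw [← ofReal_integral_eq_lintegral_ofReal, setIntegral_ball_fun_norm, hval]
  · exact (integrableOn_fun_norm_addHaar volume (f := planarPeak t)).2 (by simpa using hint)
  · exact .of_forall fun x => planarPeak_nonneg ht.le (norm_nonneg x)

/-- The correction is minus the slope of `t ↦ √(ρ² + t²)` at `0`, whose derivative there is zero; so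
the limit does not depend on `ρ`. -/
lemma tendsto_planarPeak_mass {ρ : ℝ} (hρ : 0 < ρ) :
    Tendsto (fun t => 2 * Real.pi * (1 + (ρ - √(ρ ^ 2 + t ^ 2)) / t)) (𝓝[>] 0)
      (𝓝 (2 * Real.pi)) := by
  have h1 : HasDerivAt (fun t : ℝ => √(ρ ^ 2 + t ^ 2)) 0 0 := by
    have h2 : HasDerivAt (fun t : ℝ => ρ ^ 2 + t ^ 2) 0 0 := by
      simpa using ((hasDerivAt_id (0 : ℝ)).pow 2).const_add (ρ ^ 2)
    simpa using h2.sqrt (by simpa using hρ.ne')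
  have h3 := (hasDerivAt_iff_tendsto_slope.1 h1).mono_left (nhdsGT_le_nhdsNE 0)
  have h4 : Tendsto (fun t : ℝ => 2 * Real.pi * (1 - slope (fun t : ℝ => √(ρ ^ 2 + t ^ 2)) 0 t))
      (𝓝[>] 0) (𝓝 (2 * Real.pi * (1 - 0))) := (h3.const_sub 1).const_mul _
  rw [sub_zero, mul_one] at h4
  refine h4.congr fun t => ?_
  simp only [slope_def_field, sub_zero]
  rw [zero_pow two_ne_zero, add_zero, Real.sqrt_sq hρ.le]
  ring

end PlanarIntegrals

/-! ### The peak kernel in tangent-plane coordinates. -/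

open scoped NNReal ENNReal

namespace IsPlaneProjection

variable {m : EuclideanSpace ℝ (Fin 3)}
  {p : EuclideanSpace ℝ (Fin 3) →L[ℝ] EuclideanSpace ℝ (Fin 2)}

lemma norm_le (hp : IsPlaneProjection m p) (w : EuclideanSpace ℝ (Fin 3)) : ‖p w‖ ≤ ‖w‖ :=
  (sq_le_sq₀ (norm_nonneg _) (norm_nonneg _)).1 (by nlinarith [hp w, sq_nonneg (inner ℝ w m)])

lemma norm_le_add (hp : IsPlaneProjection m p) (w : EuclideanSpace ℝ (Fin 3)) :
    ‖w‖ ≤ ‖p w‖ + |inner ℝ w m| := by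
  refine (sq_le_sq₀ (norm_nonneg _) (by positivity)).1 ?_
  nlinarith [hp w, sq_abs (inner ℝ w m), mul_nonneg (norm_nonneg (p w)) (abs_nonneg (inner ℝ w m))]

lemma apply_normal (hp : IsPlaneProjection m p) (hm : ‖m‖ = 1) : p m = 0 := by
  have h := hp m
  rw [real_inner_self_eq_norm_sq, hm] at h
  simpa using h

lemma norm_sub_smul_sq (hp : IsPlaneProjection m p) (hm : ‖m‖ = 1)
    (w : EuclideanSpace ℝ (Fin 3)) (t : ℝ) :
    ‖w - t • m‖ ^ 2 = ‖p w‖ ^ 2 + (inner ℝ w m - t) ^ 2 := by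
  have h := hp (w - t • m)
  rw [map_sub, map_smul, hp.apply_normal hm, smul_zero, sub_zero, inner_sub_left,
    real_inner_smul_left, real_inner_self_eq_norm_sq, hm] at h
  simpa using h

lemma norm_le_norm_sub_smul (hp : IsPlaneProjection m p) (hm : ‖m‖ = 1)
    (w : EuclideanSpace ℝ (Fin 3)) (t : ℝ) : ‖p w‖ ≤ ‖w - t • m‖ :=
  (sq_le_sq₀ (norm_nonneg _) (norm_nonneg _)).1
    (by nlinarith [hp.norm_sub_smul_sq hm w t, sq_nonneg (inner ℝ w m - t)])

/-- The square root is the length of `w - (⟨w, m⟩ + t) m`, which differs from `w - t m` by `⟨w, m⟩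
m`. -/
lemma abs_norm_sub_smul_sub_le (hp : IsPlaneProjection m p) (hm : ‖m‖ = 1)
    (w : EuclideanSpace ℝ (Fin 3)) (t : ℝ) :
    |‖w - t • m‖ - √(‖p w‖ ^ 2 + t ^ 2)| ≤ |inner ℝ w m| := by
  have h1 : √(‖p w‖ ^ 2 + t ^ 2) = ‖w - (inner ℝ w m + t) • m‖ := by
    rw [eq_comm, ← Real.sqrt_sq (norm_nonneg (w - _)), hp.norm_sub_smul_sq hm]
    ring_nf
  rw [h1]
  refine (abs_norm_sub_norm_le _ _).trans ?_
  have h2 : w - t • m - (w - (inner ℝ w m + t) • m) = (inner ℝ w m : ℝ) • m := by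
    module
  rw [h2, norm_smul, hm, mul_one, Real.norm_eq_abs]

end IsPlaneProjection

/-- The approximate identity `t / (|w| |w - t m| (|w| + |w - t m|))` coming from the difference
quotient of the Newtonian kernel. -/
noncomputable def normalPeak (m : EuclideanSpace ℝ (Fin 3)) (t : ℝ)
    (w : EuclideanSpace ℝ (Fin 3)) : ℝ :=
  t / (‖w‖ * ‖w - t • m‖ * (‖w‖ + ‖w - t • m‖))

lemma normalPeak_nonneg (m : EuclideanSpace ℝ (Fin 3)) {t : ℝ} (ht : 0 ≤ t)
    (w : EuclideanSpace ℝ (Fin 3)) : 0 ≤ normalPeak m t w := by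
  unfold normalPeak; positivity

lemma measurable_normalPeak (m P₀ : EuclideanSpace ℝ (Fin 3)) (t : ℝ) :
    Measurable fun P => normalPeak m t (P - P₀) := by
  unfold normalPeak; fun_prop

lemma div_mul_mul_add_le {t a b A B c : ℝ} (ht : 0 ≤ t) (hc : 0 < c) (ha : 0 < a) (hb : 0 < b)
    (hA : c * a ≤ A) (hB : c * b ≤ B) :
    t / (A * B * (A + B)) ≤ c⁻¹ ^ 3 * (t / (a * b * (a + b))) := by
  have h1 : c⁻¹ ^ 3 * (t / (a * b * (a + b))) = t / ((c * a) * (c * b) * (c * a + c * b)) := by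
    field_simp
  rw [h1]
  have : 0 < c * a := by positivity
  have : 0 < c * b := by positivity
  have : 0 < A := by linarith
  have : 0 < B := by linarith
  gcongr

/-- A small height changes the two lengths in the kernel by factors between `1 - η` and `1 + η`. The
denominator is homogeneous of degree `3` in them, hence the cubes. -/
lemma normalPeak_bounds {m w : EuclideanSpace ℝ (Fin 3)}
    {p : EuclideanSpace ℝ (Fin 3) →L[ℝ] EuclideanSpace ℝ (Fin 2)} (hp : IsPlaneProjection m p)
    (hm : ‖m‖ = 1) {η : ℝ} (hη : 0 < η) (hη1 : η < 1) (hw : |inner ℝ w m| ≤ η * ‖p w‖) {t : ℝ}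
    (ht : 0 < t) :
    normalPeak m t w ≤ (1 - η)⁻¹ ^ 3 * planarPeak t ‖p w‖ ∧
      (1 + η)⁻¹ ^ 3 * planarPeak t ‖p w‖ ≤ normalPeak m t w := by
  have h1 := hp.norm_le w
  have h2 := hp.norm_le_add w
  rcases (norm_nonneg (p w)).eq_or_lt with h0 | h0
  · rw [← h0] at hw h2 ⊢
    have h3 : ‖w‖ = 0 := le_antisymm (by linarith) (norm_nonneg w)
    simp [normalPeak, planarPeak, h3]
  have h3 := abs_le.1 (hp.abs_norm_sub_smul_sub_le hm w t)
  set r := ‖p w‖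
  have h4 : r ≤ √(r ^ 2 + t ^ 2) := Real.le_sqrt_of_sq_le (by nlinarith)
  have h5 := hp.norm_le_norm_sub_smul hm w t
  unfold normalPeak planarPeak
  set s := √(r ^ 2 + t ^ 2)
  have hs : 0 < s := h0.trans_le h4
  have h6 : η * r ≤ η * s := by gcongr
  refine ⟨div_mul_mul_add_le ht.le (by linarith) h0 hs (by nlinarith) (by linarith), ?_⟩
  have h7 := div_mul_mul_add_le (t := t) (a := ‖w‖) (b := ‖w - t • m‖) (A := r) (B := s)
    (c := (1 + η)⁻¹) ht.le (by positivity) (h0.trans_le h1) (h0.trans_le h5)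
    (by rw [inv_mul_le_iff₀ (by positivity)]; linarith)
    (by rw [inv_mul_le_iff₀ (by positivity)]; linarith)
  rw [inv_pow, inv_mul_le_iff₀ (by positivity)]
  simpa using h7

namespace IsC1AlphaNormal

variable {Γ : Set (EuclideanSpace ℝ (Fin 3))} {α : ℝ} {P₀ m : EuclideanSpace ℝ (Fin 3)}

lemma exists_flat_projection (h : IsC1AlphaNormal Γ α P₀ m)
    {p : EuclideanSpace ℝ (Fin 3) →L[ℝ] EuclideanSpace ℝ (Fin 2)} (hp : IsPlaneProjection m p)
    {η : ℝ} (hη : 0 < η) (hη1 : η < 1) :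
    ∃ ρ > 0, ∀ P ∈ Γ ∩ Metric.ball P₀ ρ, ∀ Q ∈ Γ ∩ Metric.ball P₀ ρ,
      |inner ℝ (P - Q) m| ≤ η * ‖p (P - Q)‖ := by
  -- With height `a` and `‖P - Q‖ ≤ ‖p (P - Q)‖ + a`, flatness `η / 2` gives `(1 - η/2) a ≤ (η/2) ‖p
  -- (P - Q)‖`, and `1 - η/2 > 1/2`.
  obtain ⟨ρ, hρ, h1⟩ := h.flat (η / 2) (by positivity)
  refine ⟨ρ, hρ, fun P hP Q hQ => ?_⟩
  have h2 := h1 P hP Q hQ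
  have h3 := hp.norm_le_add (P - Q)
  have h4 : 0 ≤ ‖p (P - Q)‖ := norm_nonneg _
  nlinarith [abs_nonneg (inner ℝ (P - Q) m)]

/-- Near `P₀`, flatness gives `‖w‖/2 ≤ ‖p w‖ ≤ ‖w - t m‖`; farther out `t ≤ ρ/2 ≤ ‖w‖/2`. This keeps
the denominators cubic in `‖w‖` uniformly in `t`. -/
lemma exists_half_norm_le (h : IsC1AlphaNormal Γ α P₀ m) (hP₀ : P₀ ∈ Γ) :
    ∃ t₀ : ℝ, 0 < t₀ ∧ ∀ t ∈ Set.Ioc 0 t₀, ∀ P ∈ Γ, ‖P - P₀‖ / 2 ≤ ‖P - P₀ - t • m‖ := by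
  obtain ⟨p, hp⟩ := exists_isPlaneProjection h.norm_eq
  obtain ⟨ρ, hρ, h1⟩ := h.flat (1 / 2) (by norm_num)
  refine ⟨ρ / 2, by positivity, fun t ht P hP => ?_⟩
  by_cases hb : P ∈ Metric.ball P₀ ρ
  · have h2 := h1 P ⟨hP, hb⟩ P₀ ⟨hP₀, Metric.mem_ball_self hρ⟩
    have h3 := hp.norm_le_add (P - P₀)
    have h4 := hp.norm_le_norm_sub_smul h.norm_eq (P - P₀) t
    linarith
  · rw [Metric.mem_ball, dist_eq_norm, not_lt] at hb
    have h2 := norm_sub_norm_le (P - P₀) (t • m)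
    rw [norm_smul, h.norm_eq, mul_one, Real.norm_of_nonneg ht.1.le] at h2
    linarith [ht.2]

end IsC1AlphaNormal

/-! ### Surface integrals against integrals over tangent discs. -/

/-- Comparison of surface integrals near `P₀` with integrals over discs of the tangent plane. -/
lemma exists_planar_comparison {Γ : Set (EuclideanSpace ℝ (Fin 3))} {α : ℝ}
    {P₀ m : EuclideanSpace ℝ (Fin 3)} (h : IsC1AlphaNormal Γ α P₀ m) (hP₀ : P₀ ∈ Γ)
    {p : EuclideanSpace ℝ (Fin 3) →L[ℝ] EuclideanSpace ℝ (Fin 2)} (hp : IsPlaneProjection m p)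
    {η : ℝ} (hη : 0 < η) (hη1 : η < 1) :
    ∃ ρ > 0, (∀ P ∈ Γ ∩ Metric.ball P₀ ρ, |inner ℝ (P - P₀) m| ≤ η * ‖p (P - P₀)‖) ∧
      ∃ ρ' > 0, ∀ g : EuclideanSpace ℝ (Fin 2) → ℝ≥0∞, Measurable g →
        ∫⁻ P in Γ ∩ Metric.ball P₀ ρ, g (p (P - P₀)) ∂μHE[2] ≤
          ENNReal.ofReal ((1 + η) ^ 2) * ∫⁻ x in Metric.ball 0 ρ, g x ∧
        ∫⁻ x in Metric.ball 0 ρ', g x ≤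
          ∫⁻ P in Γ ∩ Metric.ball P₀ ρ, g (p (P - P₀)) ∂μHE[2] := by
  obtain ⟨ρ, hρ, h1⟩ := h.exists_flat_projection hp hη hη1
  have hq : Measurable fun P => p (P - P₀) := by fun_prop
  have hq1 : ∀ P Q, p (P - P₀) - p (Q - P₀) = p (P - Q) := fun P Q => by
    rw [← map_sub, sub_sub_sub_cancel_right]
  obtain ⟨ρ', hρ', h2⟩ := Metric.mem_nhds_iff.1 (h.image_mem_nhds p hp ρ hρ)
  refine ⟨ρ, hρ, fun P hP => h1 P hP P₀ ⟨hP₀, Metric.mem_ball_self hρ⟩, ρ', hρ',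
    fun g hg => ⟨?_, ?_⟩⟩
  · have h3 := setLIntegral_comp_le_of_edist_le (S := Γ ∩ Metric.ball P₀ ρ) (D := Metric.ball 0 ρ)
      (K := Real.toNNReal (1 + η)) hq (fun P hP Q hQ => ?_) 2 hg ?_
    · rw [EuclideanSpace.euclideanHausdorffMeasure_eq_volume] at h3
      rwa [ENNReal.ofReal_pow (by positivity)]
    · rw [edist_dist, edist_dist, ← ENNReal.ofReal, ← ENNReal.ofReal_mul (by positivity)]
      refine ENNReal.ofReal_le_ofReal ?_
      rw [dist_eq_norm, dist_eq_norm, hq1]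
      linarith [hp.norm_le_add (P - Q), h1 P hP Q hQ]
    · rintro _ ⟨P, hP, rfl⟩
      have := hP.2
      rw [Metric.mem_ball, dist_eq_norm] at this
      simpa using (hp.norm_le (P - P₀)).trans_lt this
  · have h3 := setLIntegral_le_setLIntegral_comp (S := Γ ∩ Metric.ball P₀ ρ)
      (D := Metric.ball 0 ρ') hq (LipschitzOnWith.of_dist_le_mul fun P _ Q _ => ?_) 2 hg ?_
    · rwa [EuclideanSpace.euclideanHausdorffMeasure_eq_volume] at h3
    · rw [dist_eq_norm, dist_eq_norm, hq1, NNReal.coe_one, one_mul]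
      exact hp.norm_le _
    · intro x hx
      obtain ⟨P, hP, hPx⟩ := h2 (show x + p P₀ ∈ Metric.ball (p P₀) ρ' by simpa using hx)
      exact ⟨P, hP, by simp [hPx]⟩

namespace IsC1AlphaNormal

variable {Γ : Set (EuclideanSpace ℝ (Fin 3))} {α : ℝ} {P₀ m : EuclideanSpace ℝ (Fin 3)}

lemma exists_setLIntegral_rpow_lt_top (h : IsC1AlphaNormal Γ α P₀ m) (hΓ : MeasurableSet Γ)
    (hP₀ : P₀ ∈ Γ) {β : ℝ} (hβ : 0 ≤ β) (hβ2 : β < 2) :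
    ∃ ρ > 0, ∫⁻ P in Γ ∩ Metric.ball P₀ ρ, ENNReal.ofReal (‖P - P₀‖ ^ (-β)) ∂μHE[2] < ⊤ := by
  obtain ⟨p, hp⟩ := exists_isPlaneProjection h.norm_eq
  obtain ⟨ρ, hρ, h1, ρ', hρ', h2⟩ := exists_planar_comparison h hP₀ hp (η := 1 / 2)
    (by norm_num) (by norm_num)
  refine ⟨ρ, hρ, ?_⟩
  have h3 := (h2 (fun x => ENNReal.ofReal (‖x‖ ^ (-β))) (by fun_prop)).1
  refine lt_of_le_of_lt (le_trans (setLIntegral_mono' ?_ ?_) h3)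
    (ENNReal.mul_lt_top ENNReal.ofReal_lt_top (setLIntegral_ball_rpow_lt_top hβ2 ρ))
  · exact hΓ.inter measurableSet_ball
  · intro P hP
    refine ENNReal.ofReal_le_ofReal ?_
    -- If the projection vanishes, flatness forces `P = P₀` and the two powers coincide, whatever
    -- value a power of zero has.
    rcases (norm_nonneg (p (P - P₀))).eq_or_lt with h0 | h0
    · have h4 := h1 P hP
      have h5 := hp.norm_le_add (P - P₀)
      rw [← h0] at h4 h5
      have h6 : ‖P - P₀‖ = 0 := le_antisymm (by linarith) (norm_nonneg _)
      rw [h6, ← h0]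
    · exact Real.rpow_le_rpow_of_nonpos h0 (hp.norm_le _) (by linarith)

lemma integrableOn_rpow (h : IsC1AlphaNormal Γ α P₀ m) (hΓ : MeasurableSet Γ)
    (hfin : μHE[2] Γ < ⊤) (hP₀ : P₀ ∈ Γ) {β : ℝ} (hβ : 0 ≤ β) (hβ2 : β < 2) :
    IntegrableOn (fun P => ‖P - P₀‖ ^ (-β)) Γ μHE[2] := by
  obtain ⟨ρ, hρ, h1⟩ := h.exists_setLIntegral_rpow_lt_top hΓ hP₀ hβ hβ2
  have hm : Measurable fun P : EuclideanSpace ℝ (Fin 3) => ‖P - P₀‖ ^ (-β) := by fun_prop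
  rw [← Set.inter_union_sdiff Γ (Metric.ball P₀ ρ)]
  refine IntegrableOn.union ⟨hm.aestronglyMeasurable, ?_⟩ ?_
  · rw [hasFiniteIntegral_iff_ofReal (.of_forall fun P => by positivity)]
    exact h1
  · refine Measure.integrableOn_of_bounded (M := ρ ^ (-β))
      ((measure_mono Set.sdiff_subset).trans_lt hfin).ne hm.aestronglyMeasurable ?_
    filter_upwards [ae_restrict_mem (hΓ.diff measurableSet_ball)] with P hP
    have h2 := hP.2
    rw [Metric.mem_ball, dist_eq_norm, not_lt] at h2
    rw [Real.norm_of_nonneg (by positivity)]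
    exact Real.rpow_le_rpow_of_nonpos hρ h2 (by linarith)

lemma normalPeak_le_of_far (h : IsC1AlphaNormal Γ α P₀ m) (hP₀ : P₀ ∈ Γ) :
    ∃ t₀ : ℝ, 0 < t₀ ∧ ∀ ρ > 0, ∀ t ∈ Set.Ioc 0 t₀, ∀ P ∈ Γ \ Metric.ball P₀ ρ,
      normalPeak m t (P - P₀) ≤ t * (2 / ρ ^ 3) := by
  obtain ⟨t₀, ht₀, h1⟩ := h.exists_half_norm_le hP₀
  refine ⟨t₀, ht₀, fun ρ hρ t ht P hP => ?_⟩
  have h2 := h1 t ht P hP.1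
  have h3 := hP.2
  rw [Metric.mem_ball, dist_eq_norm, not_lt] at h3
  have h4 : t * (2 / ρ ^ 3) = t / (ρ * (ρ / 2) * (ρ + 0)) := by field_simp; ring
  rw [h4]
  unfold normalPeak
  have := ht.1
  gcongr
  · linarith
  · positivity

lemma integrableOn_normalPeak_and_tendsto (h : IsC1AlphaNormal Γ α P₀ m) (hΓ : MeasurableSet Γ)
    (hfin : μHE[2] Γ < ⊤) (hP₀ : P₀ ∈ Γ) :
    (∀ᶠ t in 𝓝[>] 0, IntegrableOn (fun P => normalPeak m t (P - P₀)) Γ μHE[2]) ∧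
    Tendsto (fun t => ∫ P in Γ, normalPeak m t (P - P₀) ∂μHE[2]) (𝓝[>] 0)
      (𝓝 (2 * Real.pi)) := by
  obtain ⟨p, hp⟩ := exists_isPlaneProjection h.norm_eq
  obtain ⟨t₀, ht₀, hfar⟩ := h.normalPeak_le_of_far hP₀
  -- For fixed `η` the mass is squeezed between bounds whose limits as `t → 0⁺` are `2π` times
  -- factors tending to `1` with `η`. The term `t * c` is the contribution away from `P₀`.
  have key : ∀ η : ℝ, 0 < η → η < 1 → ∃ ρ' > 0, ∃ c : ℝ, ∀ t ∈ Set.Ioc 0 t₀,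
      IntegrableOn (fun P => normalPeak m t (P - P₀)) Γ μHE[2] ∧
      (1 + η)⁻¹ ^ 3 * (2 * Real.pi * (1 + (ρ' - √(ρ' ^ 2 + t ^ 2)) / t)) ≤
        ∫ P in Γ, normalPeak m t (P - P₀) ∂μHE[2] ∧
      ∫ P in Γ, normalPeak m t (P - P₀) ∂μHE[2] ≤
        (1 + η) ^ 2 * (1 - η)⁻¹ ^ 3 * (2 * Real.pi) + t * c := by
    intro η hη hη1
    obtain ⟨ρ, hρ, h1, ρ', hρ', h2⟩ := exists_planar_comparison h hP₀ hp hη hη1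
    refine ⟨ρ', hρ', 2 / ρ ^ 3 * (μHE[2] : Measure _).real Γ, fun t ht => ?_⟩
    have hmeas := measurable_normalPeak m P₀ t
    have hpl : Measurable fun x : EuclideanSpace ℝ (Fin 2) => planarPeak t ‖x‖ :=
      (measurable_planarPeak t).comp measurable_norm
    have hSm : MeasurableSet (Γ ∩ Metric.ball P₀ ρ) := hΓ.inter measurableSet_ball
    have hDm : MeasurableSet (Γ \ Metric.ball P₀ ρ) := hΓ.diff measurableSet_ball
    have hη' : 0 < 1 - η := by linarith
    have hup : ∫⁻ P in Γ ∩ Metric.ball P₀ ρ, ENNReal.ofReal (normalPeak m t (P - P₀)) ∂μHE[2] ≤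
        ENNReal.ofReal ((1 + η) ^ 2 * (1 - η)⁻¹ ^ 3 * (2 * Real.pi)) := by
      have h3 := (h2 (fun x => ENNReal.ofReal ((1 - η)⁻¹ ^ 3 * planarPeak t ‖x‖))
        (hpl.const_mul _).ennreal_ofReal).1
      simp_rw [ENNReal.ofReal_mul (show 0 ≤ (1 - η)⁻¹ ^ 3 by positivity)] at h3
      rw [lintegral_const_mul _ hpl.ennreal_ofReal,
        setLIntegral_ball_planarPeak ht.1 hρ] at h3
      refine le_trans (setLIntegral_mono' hSm fun P hP => ?_) (h3.trans ?_)
      · rw [← ENNReal.ofReal_mul (by positivity)]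
        exact ENNReal.ofReal_le_ofReal
          (normalPeak_bounds hp h.norm_eq hη hη1 (h1 P hP) ht.1).1
      · rw [← ENNReal.ofReal_mul (by positivity), ← ENNReal.ofReal_mul (by positivity), ← mul_assoc]
        refine ENNReal.ofReal_le_ofReal (mul_le_mul_of_nonneg_left ?_ (by positivity))
        refine mul_le_of_le_one_right (by positivity) ?_
        have h4 : ρ ≤ √(ρ ^ 2 + t ^ 2) := Real.le_sqrt_of_sq_le (by nlinarith)
        have h5 : (ρ - √(ρ ^ 2 + t ^ 2)) / t ≤ 0 :=
          div_nonpos_of_nonpos_of_nonneg (by linarith) ht.1.le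
        linarith
    have hlow : ENNReal.ofReal
        ((1 + η)⁻¹ ^ 3 * (2 * Real.pi * (1 + (ρ' - √(ρ' ^ 2 + t ^ 2)) / t))) ≤
        ∫⁻ P in Γ ∩ Metric.ball P₀ ρ, ENNReal.ofReal (normalPeak m t (P - P₀)) ∂μHE[2] := by
      have h3 := (h2 (fun x => ENNReal.ofReal ((1 + η)⁻¹ ^ 3 * planarPeak t ‖x‖))
        (hpl.const_mul _).ennreal_ofReal).2
      simp_rw [ENNReal.ofReal_mul (show 0 ≤ (1 + η)⁻¹ ^ 3 by positivity)] at h3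
      rw [lintegral_const_mul _ hpl.ennreal_ofReal,
        setLIntegral_ball_planarPeak ht.1 hρ', ← ENNReal.ofReal_mul (by positivity)] at h3
      refine h3.trans (setLIntegral_mono' hSm fun P hP => ?_)
      rw [← ENNReal.ofReal_mul (by positivity)]
      exact ENNReal.ofReal_le_ofReal (normalPeak_bounds hp h.norm_eq hη hη1 (h1 P hP) ht.1).2
    have hnn : ∀ P, 0 ≤ normalPeak m t (P - P₀) := fun P => normalPeak_nonneg m ht.1.le _
    have hI1 : IntegrableOn (fun P => normalPeak m t (P - P₀)) (Γ ∩ Metric.ball P₀ ρ) μHE[2] := by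
      refine ⟨hmeas.aestronglyMeasurable, ?_⟩
      rw [hasFiniteIntegral_iff_ofReal (.of_forall hnn)]
      exact hup.trans_lt ENNReal.ofReal_lt_top
    have hbd : ∀ᵐ P ∂(μHE[2] : Measure _).restrict (Γ \ Metric.ball P₀ ρ),
        ‖normalPeak m t (P - P₀)‖ ≤ t * (2 / ρ ^ 3) := by
      filter_upwards [ae_restrict_mem hDm] with P hP
      rw [Real.norm_of_nonneg (hnn P)]
      exact hfar ρ hρ t ht P hP
    have hDfin : μHE[2] (Γ \ Metric.ball P₀ ρ) < ⊤ := (measure_mono Set.sdiff_subset).trans_lt hfin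
    have hI2 : IntegrableOn (fun P => normalPeak m t (P - P₀)) (Γ \ Metric.ball P₀ ρ) μHE[2] :=
      Measure.integrableOn_of_bounded hDfin.ne hmeas.aestronglyMeasurable hbd
    have hI : IntegrableOn (fun P => normalPeak m t (P - P₀)) Γ μHE[2] := by
      simpa only [Set.inter_union_sdiff] using hI1.union hI2
    have hsplit := integral_inter_add_sdiff (measurableSet_ball (x := P₀) (ε := ρ)) hI
    rw [← ofReal_integral_eq_lintegral_ofReal hI1 (.of_forall hnn)] at hup hlow
    have hup' := (ENNReal.ofReal_le_ofReal_iff (by positivity)).1 hup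
    have hlow' := (ENNReal.ofReal_le_ofReal_iff (setIntegral_nonneg hSm fun P _ => hnn P)).1 hlow
    have hD0 := setIntegral_nonneg (μ := μHE[2]) hDm fun P _ => hnn P
    have hD1 := norm_setIntegral_le_of_norm_le_const_ae hDfin hbd
    have hD2 : t * (2 / ρ ^ 3) * (μHE[2] : Measure _).real (Γ \ Metric.ball P₀ ρ) ≤
        t * (2 / ρ ^ 3) * (μHE[2] : Measure _).real Γ := by
      have := ht.1
      gcongr
      · exact hfin.ne
      · exact Set.sdiff_subset
    rw [Real.norm_of_nonneg hD0] at hD1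
    exact ⟨hI, by linarith, by linarith⟩
  have hev : ∀ᶠ t in 𝓝[>] (0 : ℝ), t ∈ Set.Ioc 0 t₀ := Ioc_mem_nhdsGT ht₀
  have hη : ∀ᶠ η in 𝓝[>] (0 : ℝ), 0 < η ∧ η < 1 := Ioo_mem_nhdsGT one_pos
  refine ⟨?_, tendsto_order.2 ⟨fun a ha => ?_, fun b hb => ?_⟩⟩
  · obtain ⟨ρ', _, c, hk⟩ := key (1 / 2) (by norm_num) (by norm_num)
    exact hev.mono fun t ht => (hk t ht).1
  · have h1 : Tendsto (fun η : ℝ => (1 + η)⁻¹ ^ 3 * (2 * Real.pi)) (𝓝[>] 0)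
        (𝓝 (2 * Real.pi)) := by
      have : ContinuousAt (fun η : ℝ => (1 + η)⁻¹ ^ 3 * (2 * Real.pi)) 0 := by
        fun_prop (disch := norm_num)
      simpa [ContinuousAt] using this.tendsto.mono_left nhdsWithin_le_nhds
    obtain ⟨η, ⟨h0, h01⟩, h2⟩ := (hη.and (h1.eventually (lt_mem_nhds ha))).exists
    obtain ⟨ρ', hρ', c, hk⟩ := key η h0 h01
    filter_upwards [hev, ((tendsto_planarPeak_mass hρ').const_mul ((1 + η)⁻¹ ^ 3)).eventually
      (lt_mem_nhds h2)] with t ht h3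
    exact h3.trans_le (hk t ht).2.1
  · have h1 : Tendsto (fun η : ℝ => (1 + η) ^ 2 * (1 - η)⁻¹ ^ 3 * (2 * Real.pi)) (𝓝[>] 0)
        (𝓝 (2 * Real.pi)) := by
      have : ContinuousAt (fun η : ℝ => (1 + η) ^ 2 * (1 - η)⁻¹ ^ 3 * (2 * Real.pi)) 0 := by
        fun_prop (disch := norm_num)
      simpa [ContinuousAt] using this.tendsto.mono_left nhdsWithin_le_nhds
    obtain ⟨η, ⟨h0, h01⟩, h2⟩ := (hη.and (h1.eventually (gt_mem_nhds hb))).exists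
    obtain ⟨ρ', hρ', c, hk⟩ := key η h0 h01
    have h3 : Tendsto (fun t : ℝ => (1 + η) ^ 2 * (1 - η)⁻¹ ^ 3 * (2 * Real.pi) + t * c)
        (𝓝[>] 0) (𝓝 ((1 + η) ^ 2 * (1 - η)⁻¹ ^ 3 * (2 * Real.pi))) := by
      have : Continuous fun t : ℝ =>
        (1 + η) ^ 2 * (1 - η)⁻¹ ^ 3 * (2 * Real.pi) + t * c := by fun_prop
      simpa using (this.tendsto 0).mono_left nhdsWithin_le_nhds
    filter_upwards [hev, h3.eventually (gt_mem_nhds h2)] with t ht h4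
    exact (hk t ht).2.2.trans_lt h4

end IsC1AlphaNormal

/-! ### Kernel formula, finite area and absolute convergence. -/

lemma normalDerivKernel_eq {n P₀ P : EuclideanSpace ℝ (Fin 3)} (hP : P ≠ P₀) :
    normalDerivKernel n P₀ P = inner ℝ (P - P₀) n / ‖P - P₀‖ ^ 3 := by
  have hpos : 0 < ‖P - P₀‖ := norm_pos_iff.2 (sub_ne_zero.2 hP)
  have h1 : HasDerivAt (fun t : ℝ => ‖(P - P₀) - t • n‖ ^ 2)
      (-(2 * inner ℝ (P - P₀) n)) 0 := by
    have h2 : HasDerivAt (fun t : ℝ => (P - P₀) - t • n) (-n) 0 := by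
      simpa using ((hasDerivAt_id (0 : ℝ)).smul_const n).const_sub (P - P₀)
    simpa [inner_neg_right] using h2.norm_sq
  have h3 := (h1.sqrt (by simpa using hpos.ne')).fun_inv (by simpa using hpos.ne')
  refine HasLineDerivAt.lineDeriv (h3.congr_of_eventuallyEq (.of_forall fun t => ?_) |>.congr_deriv ?_)
  · simp only [one_div, dist_eq_norm, Real.sqrt_sq (norm_nonneg _), sub_add_eq_sub_sub]
  · simp only [zero_smul, sub_zero, Real.sqrt_sq (norm_nonneg _)]
    field_simp

lemma IsCompact.euclideanHausdorffMeasure_lt_top {Γ : Set (EuclideanSpace ℝ (Fin 3))} {α : ℝ}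
    (hΓ : IsCompact Γ) (h : ∀ P ∈ Γ, ∃ m, IsC1AlphaNormal Γ α P m) : μHE[2] Γ < ⊤ := by
  refine hΓ.measure_lt_top_of_nhdsWithin fun P hP => ?_
  obtain ⟨m, hm⟩ := h P hP
  -- With exponent `0` the integrand is `1`, so local integrability says that small surface pieces
  -- have finite area.
  obtain ⟨ρ, hρ, h1⟩ := hm.exists_setLIntegral_rpow_lt_top hΓ.measurableSet hP le_rfl two_pos
  exact ⟨Γ ∩ Metric.ball P ρ, inter_mem self_mem_nhdsWithin
    (mem_nhdsWithin_of_mem_nhds (Metric.ball_mem_nhds _ hρ)), by simpa using h1⟩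

lemma aestronglyMeasurable_mul_of_continuousOn {Γ : Set (EuclideanSpace ℝ (Fin 3))}
    (hΓ : IsCompact Γ) {v : EuclideanSpace ℝ (Fin 3) → ℝ} (hv : ContinuousOn v Γ)
    {g : EuclideanSpace ℝ (Fin 3) → ℝ} (hg : Measurable g) :
    AEStronglyMeasurable (fun P => v P * g P) ((μHE[2] : Measure _).restrict Γ) :=
  (hv.aestronglyMeasurable hΓ.measurableSet).mul hg.aestronglyMeasurable

lemma integrableOn_mul_of_continuousOn {Γ : Set (EuclideanSpace ℝ (Fin 3))}
    (hΓ : IsCompact Γ) {v : EuclideanSpace ℝ (Fin 3) → ℝ} (hv : ContinuousOn v Γ)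
    {g : EuclideanSpace ℝ (Fin 3) → ℝ} (hg : IntegrableOn g Γ μHE[2]) :
    IntegrableOn (fun P => v P * g P) Γ μHE[2] := by
  obtain ⟨V, hV⟩ := hΓ.exists_bound_of_continuousOn hv
  exact hg.bdd_mul (hv.aestronglyMeasurable hΓ.measurableSet)
    (ae_restrict_of_forall_mem hΓ.measurableSet hV)

lemma integrableOn_singleLayer {Γ : Set (EuclideanSpace ℝ (Fin 3))} {α : ℝ}
    (hΓ : IsCompact Γ) (h : ∀ P ∈ Γ, ∃ m, IsC1AlphaNormal Γ α P m)
    {v : EuclideanSpace ℝ (Fin 3) → ℝ} (hv : ContinuousOn v Γ)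
    (M : EuclideanSpace ℝ (Fin 3)) : IntegrableOn (fun P => v P / dist P M) Γ μHE[2] := by
  have hfin := hΓ.euclideanHausdorffMeasure_lt_top h
  simp_rw [div_eq_mul_inv]
  refine integrableOn_mul_of_continuousOn hΓ hv ?_
  by_cases hM : M ∈ Γ
  · obtain ⟨m, hm⟩ := h M hM
    simpa [Real.rpow_neg_one, dist_eq_norm] using
      hm.integrableOn_rpow hΓ.measurableSet hfin hM zero_le_one one_lt_two
  · refine ContinuousOn.integrableOn_of_subset_isCompact ?_ hΓ hΓ.measurableSet le_rfl hfin.ne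
    exact (continuous_id.dist continuous_const).continuousOn.inv₀ fun P hP h0 =>
      hM (dist_eq_zero.1 h0 ▸ hP)

/-! ### Limits of the regular and peak parts. -/

namespace IsC1AlphaNormal

variable {Γ : Set (EuclideanSpace ℝ (Fin 3))} {α : ℝ} {P₀ m : EuclideanSpace ℝ (Fin 3)}

/-- The difference quotient of the Newtonian kernel, without its singular part. -/
noncomputable def regularQuotient (m : EuclideanSpace ℝ (Fin 3)) (t : ℝ)
    (w : EuclideanSpace ℝ (Fin 3)) : ℝ :=
  2 * inner ℝ w m / (‖w‖ * ‖w - t • m‖ * (‖w‖ + ‖w - t • m‖))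

lemma newton_quotient_eq (hm : ‖m‖ = 1) {t : ℝ} (ht : t ≠ 0) {w : EuclideanSpace ℝ (Fin 3)}
    (hw : 0 < ‖w‖) (hwt : 0 < ‖w - t • m‖) :
    (‖w - t • m‖⁻¹ - ‖w‖⁻¹) / t = regularQuotient m t w - normalPeak m t w := by
  have h1 : ‖w - t • m‖ ^ 2 = ‖w‖ ^ 2 - 2 * t * inner ℝ w m + t ^ 2 := by
    rw [norm_sub_sq_real, norm_smul, hm, real_inner_smul_right, Real.norm_eq_abs, mul_one, sq_abs]
    ring
  unfold regularQuotient normalPeak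
  field_simp
  linear_combination -h1

/-- Contact of order `1 + α` in the numerator against a denominator at least `‖w‖³/2`, uniformly in
`t`; this is the dominating function. -/
lemma abs_regularQuotient_le (h : IsC1AlphaNormal Γ α P₀ m) (hP₀ : P₀ ∈ Γ) :
    ∃ C, ∃ t₀ : ℝ, 0 < t₀ ∧ ∀ t ∈ Set.Ioc 0 t₀, ∀ P ∈ Γ,
      |regularQuotient m t (P - P₀)| ≤ C * ‖P - P₀‖ ^ (-(2 - α)) := by
  obtain ⟨C, hC, h1⟩ := h.contact
  obtain ⟨t₀, ht₀, h2⟩ := h.exists_half_norm_le hP₀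
  refine ⟨4 * C, t₀, ht₀, fun t ht P hP => ?_⟩
  have h3 := h1 P hP
  have h4 := h2 t ht P hP
  rcases (norm_nonneg (P - P₀)).eq_or_lt with h0 | h0
  · simp only [regularQuotient, ← h0, zero_mul, div_zero, abs_zero]
    positivity
  have h5 : ‖P - P₀‖ ^ (-(2 - α)) = ‖P - P₀‖ ^ (1 + α) / ‖P - P₀‖ ^ 3 := by
    rw [← Real.rpow_natCast, ← Real.rpow_sub h0]
    congr 1
    push_cast
    ring
  unfold regularQuotient
  rw [h5, abs_div, abs_mul, abs_two,
    abs_of_nonneg (show 0 ≤ ‖P - P₀‖ * ‖P - P₀ - t • m‖ * (‖P - P₀‖ + ‖P - P₀ - t • m‖) by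
      positivity)]
  calc 2 * |inner ℝ (P - P₀) m| / (‖P - P₀‖ * ‖P - P₀ - t • m‖ * (‖P - P₀‖ + ‖P - P₀ - t • m‖))
      ≤ 2 * (C * ‖P - P₀‖ ^ (1 + α)) / (‖P - P₀‖ * (‖P - P₀‖ / 2) * (‖P - P₀‖ + 0)) := by
        gcongr
        positivity
    _ = 4 * C * (‖P - P₀‖ ^ (1 + α) / ‖P - P₀‖ ^ 3) := by
        field_simp
        ring

lemma tendsto_regularQuotient {w : EuclideanSpace ℝ (Fin 3)} (hw : w ≠ 0) :
    Tendsto (fun t => regularQuotient m t w) (𝓝[>] 0) (𝓝 (inner ℝ w m / ‖w‖ ^ 3)) := by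
  have h0 : 0 < ‖w‖ := norm_pos_iff.2 hw
  have h1 : ContinuousAt (fun t : ℝ => regularQuotient m t w) 0 := by
    unfold regularQuotient
    refine ContinuousAt.div (by fun_prop) (by fun_prop) ?_
    simp only [zero_smul, sub_zero]
    positivity
  have h2 : regularQuotient m 0 w = inner ℝ w m / ‖w‖ ^ 3 := by
    simp only [regularQuotient, zero_smul, sub_zero]
    field_simp
    ring
  rw [← h2]
  exact h1.tendsto.mono_left nhdsWithin_le_nhds

lemma measurable_regularQuotient (t : ℝ) :
    Measurable fun P => regularQuotient m t (P - P₀) := by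
  unfold regularQuotient; fun_prop

/-- Two-dimensional Hausdorff measure has no atoms, so the values of the kernels at the singular
point are irrelevant. -/
lemma ae_ne (Γ : Set (EuclideanSpace ℝ (Fin 3))) (P₀ : EuclideanSpace ℝ (Fin 3)) :
    ∀ᵐ P ∂(μHE[2] : Measure _).restrict Γ, P ≠ P₀ := by
  refine ae_restrict_of_ae ?_
  rw [Measure.euclideanHausdorffMeasure_def, ENNReal.smul_def]
  have : NullSingletonClass (μH[(2 : ℕ)] : Measure (EuclideanSpace ℝ (Fin 3))) :=
    Measure.nullSingletonClass_hausdorff _ (by norm_num)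
  exact Measure.ae_smul_measure (Measure.ae_ne _ P₀) _

lemma integrableOn_normalDeriv (h : IsC1AlphaNormal Γ α P₀ m) (hα : 0 < α) (hα1 : α ≤ 1)
    (hΓ : IsCompact Γ) (hfin : μHE[2] Γ < ⊤) (hP₀ : P₀ ∈ Γ) :
    IntegrableOn (fun P => inner ℝ (P - P₀) m / ‖P - P₀‖ ^ 3) Γ μHE[2] := by
  obtain ⟨C, hC, h1⟩ := h.contact
  refine ((h.integrableOn_rpow hΓ.measurableSet hfin hP₀ (β := 2 - α) (by linarith)
    (by linarith)).const_mul C).mono' (Measurable.aestronglyMeasurable (by fun_prop)) ?_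
  filter_upwards [ae_restrict_mem hΓ.measurableSet, ae_ne Γ P₀] with P hP hne
  have h0 : 0 < ‖P - P₀‖ := norm_pos_iff.2 (sub_ne_zero.2 hne)
  have h5 : ‖P - P₀‖ ^ (-(2 - α)) = ‖P - P₀‖ ^ (1 + α) / ‖P - P₀‖ ^ 3 := by
    rw [← Real.rpow_natCast, ← Real.rpow_sub h0]
    congr 1
    push_cast
    ring
  rw [h5, norm_div, Real.norm_eq_abs, norm_pow, norm_norm, ← mul_div_assoc]
  gcongr
  exact h1 P hP

variable {v : EuclideanSpace ℝ (Fin 3) → ℝ}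

lemma tendsto_integral_regularQuotient (h : IsC1AlphaNormal Γ α P₀ m) (hα : 0 < α) (hα1 : α ≤ 1)
    (hΓ : IsCompact Γ) (hfin : μHE[2] Γ < ⊤) (hP₀ : P₀ ∈ Γ) (hv : ContinuousOn v Γ) :
    (∀ᶠ t in 𝓝[>] 0,
      IntegrableOn (fun P => v P * regularQuotient m t (P - P₀)) Γ μHE[2]) ∧
    Tendsto (fun t => ∫ P in Γ, v P * regularQuotient m t (P - P₀) ∂μHE[2]) (𝓝[>] 0)
      (𝓝 (∫ P in Γ, v P * (inner ℝ (P - P₀) m / ‖P - P₀‖ ^ 3) ∂μHE[2])) := by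
  obtain ⟨C, t₀, ht₀, h1⟩ := h.abs_regularQuotient_le hP₀
  have hint := (h.integrableOn_rpow hΓ.measurableSet hfin hP₀ (β := 2 - α) (by linarith)
    (by linarith)).const_mul C
  have hev : ∀ᶠ t in 𝓝[>] (0 : ℝ), t ∈ Set.Ioc 0 t₀ := Ioc_mem_nhdsGT ht₀
  have hdom := integrableOn_mul_of_continuousOn hΓ hv.abs hint
  have hbd : ∀ t ∈ Set.Ioc 0 t₀, ∀ᵐ P ∂(μHE[2] : Measure _).restrict Γ,
      ‖v P * regularQuotient m t (P - P₀)‖ ≤ |v P| * (C * ‖P - P₀‖ ^ (-(2 - α))) := by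
    intro t ht
    filter_upwards [ae_restrict_mem hΓ.measurableSet] with P hP
    rw [norm_mul, Real.norm_eq_abs, Real.norm_eq_abs]
    gcongr
    exact h1 t ht P hP
  have hmeas := fun t => aestronglyMeasurable_mul_of_continuousOn hΓ hv
    (measurable_regularQuotient (m := m) (P₀ := P₀) t)
  refine ⟨hev.mono fun t ht => hdom.mono' (hmeas t) (hbd t ht), ?_⟩
  refine tendsto_integral_filter_of_dominated_convergence _ (.of_forall hmeas)
    (hev.mono hbd) hdom ?_
  filter_upwards [ae_ne Γ P₀] with P hne
  exact (tendsto_regularQuotient (sub_ne_zero.2 hne)).const_mul _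

lemma tendsto_integral_normalPeak (h : IsC1AlphaNormal Γ α P₀ m)
    (hΓ : IsCompact Γ) (hfin : μHE[2] Γ < ⊤) (hP₀ : P₀ ∈ Γ) (hv : ContinuousOn v Γ) :
    Tendsto (fun t => ∫ P in Γ, v P * normalPeak m t (P - P₀) ∂μHE[2]) (𝓝[>] 0)
      (𝓝 (2 * Real.pi * v P₀)) := by
  obtain ⟨-, hmass⟩ := h.integrableOn_normalPeak_and_tendsto hΓ.measurableSet hfin hP₀
  obtain ⟨t₀, ht₀, hfar⟩ := h.normalPeak_le_of_far hP₀
  have hev : ∀ᶠ t in 𝓝[>] (0 : ℝ), t ∈ Set.Ioc 0 t₀ := Ioc_mem_nhdsGT ht₀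
  have h2π : (0 : ℝ) < 2 * Real.pi := by positivity
  -- Dividing by `2π` normalises the limiting mass to `1`; the far bound gives uniform decay off
  -- every neighbourhood of `P₀`.
  have hpeak := tendsto_setIntegral_peak_smul_of_integrableOn_of_tendsto (μ := μHE[2])
    (s := Γ) (t := Γ) (l := 𝓝[>] (0 : ℝ)) (x₀ := P₀) (g := v) (a := v P₀)
    (φ := fun t P => (2 * Real.pi)⁻¹ * normalPeak m t (P - P₀)) hΓ.measurableSet hΓ.measurableSet
    subset_rfl self_mem_nhdsWithin hfin.ne ?_ ?_ ?_ ?_ ?_ (hv P₀ hP₀)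
  · refine (hpeak.const_mul (2 * Real.pi)).congr fun t => ?_
    rw [← integral_const_mul]
    refine integral_congr_ae (.of_forall fun P => ?_)
    simp only [smul_eq_mul]
    field_simp
  · exact hev.mono fun t ht P _ => mul_nonneg (by positivity) (normalPeak_nonneg m ht.1.le _)
  · intro u hu hPu
    obtain ⟨ρ, hρ, hball⟩ := Metric.isOpen_iff.1 hu P₀ hPu
    rw [Metric.tendstoUniformlyOn_iff]
    intro ε hε
    have hsmall : Tendsto (fun t : ℝ => (2 * Real.pi)⁻¹ * (t * (2 / ρ ^ 3))) (𝓝[>] 0) (𝓝 0) := by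
      have : Continuous fun t : ℝ => (2 * Real.pi)⁻¹ * (t * (2 / ρ ^ 3)) := by fun_prop
      simpa using (this.tendsto 0).mono_left nhdsWithin_le_nhds
    filter_upwards [hev, hsmall.eventually (gt_mem_nhds hε)] with t ht hlt P hP
    have h1 : 0 ≤ (2 * Real.pi)⁻¹ * normalPeak m t (P - P₀) :=
      mul_nonneg (by positivity) (normalPeak_nonneg m ht.1.le _)
    rw [Pi.zero_apply, dist_zero_left, Real.norm_of_nonneg h1]
    refine lt_of_le_of_lt (mul_le_mul_of_nonneg_left ?_ (by positivity)) hlt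
    exact hfar ρ hρ t ht P ⟨hP.1, fun hb => hP.2 (hball hb)⟩
  · simp_rw [integral_const_mul]
    have := hmass.const_mul (2 * Real.pi)⁻¹
    rwa [inv_mul_cancel₀ h2π.ne'] at this
  · exact .of_forall fun t => ((measurable_normalPeak m P₀ t).const_mul _).aestronglyMeasurable
  · exact hv.integrableOn_of_subset_isCompact hΓ hΓ.measurableSet le_rfl hfin.ne

/-- The one-sided derivative of the single-layer potential along either unit normal `m`. -/
theorem tendsto_singleLayer_quotient (h : IsC1AlphaNormal Γ α P₀ m) (hα : 0 < α) (hα1 : α ≤ 1)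
    (hΓ : IsCompact Γ) (hnormal : ∀ P ∈ Γ, ∃ m, IsC1AlphaNormal Γ α P m) (hP₀ : P₀ ∈ Γ)
    (hv : ContinuousOn v Γ) :
    Tendsto (fun t : ℝ => ((∫ P in Γ, v P / dist P (P₀ + t • m) ∂μHE[2]) -
      ∫ P in Γ, v P / dist P P₀ ∂μHE[2]) / t) (𝓝[>] 0)
      (𝓝 ((∫ P in Γ, v P * (inner ℝ (P - P₀) m / ‖P - P₀‖ ^ 3) ∂μHE[2]) -
        2 * Real.pi * v P₀)) := by
  have hfin := hΓ.euclideanHausdorffMeasure_lt_top hnormal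
  obtain ⟨hreg, hreglim⟩ := h.tendsto_integral_regularQuotient hα hα1 hΓ hfin hP₀ hv
  have hpeak := (h.integrableOn_normalPeak_and_tendsto hΓ.measurableSet hfin hP₀).1
  obtain ⟨t₀, ht₀, hhalf⟩ := h.exists_half_norm_le hP₀
  have hev : ∀ᶠ t in 𝓝[>] (0 : ℝ), t ∈ Set.Ioc 0 t₀ := Ioc_mem_nhdsGT ht₀
  refine (hreglim.sub (h.tendsto_integral_normalPeak hΓ hfin hP₀ hv)).congr' ?_
  filter_upwards [hreg, hpeak, hev] with t hr hp ht
  rw [← integral_sub hr (integrableOn_mul_of_continuousOn hΓ hv hp),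
    ← integral_sub (integrableOn_singleLayer hΓ hnormal hv _)
      (integrableOn_singleLayer hΓ hnormal hv _), ← integral_div]
  refine integral_congr_ae ?_
  filter_upwards [ae_restrict_mem hΓ.measurableSet, ae_ne Γ P₀] with P hP hne
  have h0 : 0 < ‖P - P₀‖ := norm_pos_iff.2 (sub_ne_zero.2 hne)
  have h1 : 0 < ‖P - P₀ - t • m‖ := by linarith [hhalf t ht P hP]
  have h2 := newton_quotient_eq h.norm_eq ht.1.ne' h0 h1
  rw [dist_eq_norm, dist_eq_norm, ← sub_sub, ← mul_sub, ← h2]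
  ring

end IsC1AlphaNormal

/-! ### The jump relations. -/

theorem theorem2p3 (Ω : Set (EuclideanSpace ℝ (Fin 3))) (hΩ_open : IsOpen Ω)
    (hΩ_conn : IsConnected Ω) (hΩ_bdd : Bornology.IsBounded Ω)
    (α : ℝ) (hα_pos : 0 < α) (hα_le : α ≤ 1) (hΩ_bdry : HasC1AlphaBoundary Ω α)
    (v : EuclideanSpace ℝ (Fin 3) → ℝ) (hv : ContinuousOn v (frontier Ω)) :
    (∀ M : EuclideanSpace ℝ (Fin 3),
      Integrable (fun P => v P / dist P M) (surfaceMeasure Ω)) ∧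
    ∀ P₀ ∈ frontier Ω,
      (∃! n : EuclideanSpace ℝ (Fin 3), IsExteriorUnitNormal Ω P₀ n) ∧
      ∀ n : EuclideanSpace ℝ (Fin 3), IsExteriorUnitNormal Ω P₀ n →
        Integrable (fun P => v P * normalDerivKernel n P₀ P) (surfaceMeasure Ω) ∧
        HasExteriorNormalDeriv (singleLayer Ω v) P₀ n
          ((∫ P, v P * normalDerivKernel n P₀ P ∂(surfaceMeasure Ω)) - 2 * Real.pi * v P₀) ∧
        HasInteriorNormalDeriv (singleLayer Ω v) P₀ n
          ((∫ P, v P * normalDerivKernel n P₀ P ∂(surfaceMeasure Ω)) + 2 * Real.pi * v P₀) := by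
  have hΓ : IsCompact (frontier Ω) :=
    Metric.isCompact_of_isClosed_isBounded isClosed_frontier
      (hΩ_bdd.closure.subset frontier_subset_closure)
  have hnormal : ∀ P ∈ frontier Ω, ∃ m, IsC1AlphaNormal (frontier Ω) α P m := fun P hP =>
    (hΩ_bdry.exists_normal hα_pos hP).imp fun _ h => h.2.2
  have hfin := hΓ.euclideanHausdorffMeasure_lt_top hnormal
  refine ⟨fun M => integrableOn_singleLayer hΓ hnormal hv M, fun P₀ hP₀ => ?_⟩
  obtain ⟨n₀, hn₀, huniq, h⟩ := hΩ_bdry.exists_normal hα_pos hP₀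
  refine ⟨⟨n₀, hn₀, huniq⟩, fun n hn => ?_⟩
  obtain rfl := huniq n hn
  have hker : (fun P => v P * normalDerivKernel n P₀ P) =ᵐ[surfaceMeasure Ω]
      fun P => v P * (inner ℝ (P - P₀) n / ‖P - P₀‖ ^ 3) := by
    filter_upwards [IsC1AlphaNormal.ae_ne (frontier Ω) P₀] with P hne
    rw [normalDerivKernel_eq hne]
  rw [integral_congr_ae hker]
  refine ⟨(integrable_congr hker).2 (integrableOn_mul_of_continuousOn hΓ hv
    (h.integrableOn_normalDeriv hα_pos hα_le hΓ hfin hP₀)), ?_, ?_⟩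
  · refine (h.tendsto_singleLayer_quotient hα_pos hα_le hΓ hnormal hP₀ hv).congr' ?_
    filter_upwards [self_mem_nhdsWithin] with t ht
    have h1 : dist (P₀ + t • n) P₀ = t := by
      rw [dist_eq_norm, add_sub_cancel_left, norm_smul, h.norm_eq, mul_one,
        Real.norm_of_nonneg (le_of_lt ht)]
    rw [h1]
    rfl
  -- The interior derivative along `n` is minus the one-sided derivative along `-n`. The kernel is
  -- odd in the normal and so keeps its sign, while the jump term is even and changes sign.
  · have h2 := (h.neg.tendsto_singleLayer_quotient hα_pos hα_le hΓ hnormal hP₀ hv).neg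
    simp only [inner_neg_right, neg_div, mul_neg, integral_neg] at h2
    have h3 : -(-(∫ P in frontier Ω, v P * (inner ℝ (P - P₀) n / ‖P - P₀‖ ^ 3) ∂μHE[2]) -
        2 * Real.pi * v P₀) = (∫ P, v P * (inner ℝ (P - P₀) n / ‖P - P₀‖ ^ 3)
          ∂(surfaceMeasure Ω)) + 2 * Real.pi * v P₀ := by
      rw [surfaceMeasure]; ring
    rw [h3] at h2
    refine h2.congr' ?_
    filter_upwards [self_mem_nhdsWithin] with t ht
    have h1 : dist P₀ (P₀ - t • n) = t := by
      rw [dist_eq_norm, sub_sub_cancel, norm_smul, h.norm_eq, mul_one,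
        Real.norm_of_nonneg (le_of_lt ht)]
    rw [h1, ← neg_div, neg_sub, smul_neg, ← sub_eq_add_neg]
    rfl
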